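/- **Definitions.** Let $E=\mathbb{R}^d$ with Euclidean inner product $\langle\cdot,\cdot\rangle$ and norm $|\cdot|$, and write $\widehat{\mu}(z)=\int_{E} e^{\mathrm{i}\langle z,x\rangle}\,\mu(\mathrm{d}x)$. A probability measure $\mu$ on $E$ is *infinitely divisible* if for each $n\ge 1$ it is the $n$-fold convolution of some probability measure with itself, and *quasi-infinitely divisible* (QID) if $\widehat{\mu}(z)=\widehat{\mu}_1(z)/\widehat{\mu}_2(z)$ for all $z$, with infinitely divisible $\mu_1,\mu_2$. Let $\mathcal{B}_0^d$ be the class of Borel sets $B\subset\mathbb{R}^d$ that are contained in $\{|x|\ge r\}$ for some $r>0$. A *quasi-Lévy type measure* is a function $\nu:\mathcal{B}_0^d\to\mathbb{R}$ which, for each $r>0$, is a finite signed measure on the Borel subsets of $\{|x|\ge r\}$, and for which $\int (1\wedge|x|^2)\,\nu^{\pm}(\mathrm{d}x)<\infty$; here $\nu^+,\nu^-$ are the Borel measures on $\mathbb{R}^d$ with no mass at $0$ which on the Borel subsets of each $\{|x|\ge r\}$ are the positive and negative part of $\nu$. Integrals are $\int f\,\mathrm{d}\nu=\int f\,\mathrm{d}\nu^+-\int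 f\,\mathrm{d}\nu^-$. A *(standard) characteristic triplet* of $\mu$ is a triplet $(A,\nu,\gamma)$ of a symmetric matrix $A\in\mathbb{R}^{d\times d}$, a quasi-Lévy type measure $\nu$ on $\mathbb{R}^d$ and $\gamma\in\mathbb{R}^d$ such that for all $z\in\mathbb{R}^d$ $$\widehat{\mu}(z)=\exp\Big(\mathrm{i}\langle\gamma,z\rangle-\tfrac12\langle z,Az\rangle+\int_{\mathbb{R}^d}\big(e^{\mathrm{i}\langle z,x\rangle}-1-\mathrm{i}\langle z,x\rangle\mathbf{1}_{[0,1]}(|x|)\big)\,\nu(\mathrm{d}x)\Big).$$ **Proposition.** Let $X_1,\dots,X_d$ be independent real-valued random variables and $X=(X_1,\dots,X_d)^T$. Then the law $\mathcal{L}(X)$ is quasi-infinitely divisible if and only if $\mathcal{L}(X_k)$ is quasi-infinitely divisible for every $k\in\{1,\dots,d\}$. In this case $\mathcal{L}(X)$ has exactly one characteristic triplet $(A,\nu,\gamma)$, each $\mathcal{L}(X_k)$ has exactly one characteristic triplet $(a_k,\nu_k,\gamma_k)$, and $$A=\operatorname{diag}(a_1,\dots,a_d),\qquad \gamma=(\gamma_1,\dots,\gamma_d)^T,\qquad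 \nu=\sum_{k=1}^d\delta_0^{\otimes(k-1)}\otimes\nu_k\otimes\delta_0^{\otimes(d-k)},$$ the last equation meaning that $\nu(B)=\sum_{k=1}^d\nu_k(\{x\in\mathbb{R}: x e_k\in B\})$ for all $B\in\mathcal{B}_0^d$, where $e_k$ is the $k$-th unit vector. -/

import Mathlib

open MeasureTheory ProbabilityTheory Function
open scoped RealInnerProductSpace

noncomputable section

/-- The `n`-fold convolution of a measure with itself. -/
def convPow {E : Type*} [AddMonoid E] [MeasurableSpace E] (ρ : Measure E) : ℕ → Measure E
  | 0 => Measure.dirac 0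
  | n + 1 => (convPow ρ n).conv ρ

/-- A probability distribution is infinitely divisible if for every `n ≥ 1` it is the `n`-fold
convolution of some probability distribution with itself. -/
def IsInfinitelyDivisible {E : Type*} [AddMonoid E] [MeasurableSpace E] (μ : Measure E) : Prop :=
  IsProbabilityMeasure μ ∧
    ∀ n : ℕ, 1 ≤ n → ∃ ρ : Measure E, IsProbabilityMeasure ρ ∧ convPow ρ n = μ

/-- A probability distribution is quasi-infinitely divisible if its characteristic function is the
quotient of the characteristic functions of two infinitely divisible distributions. -/
def IsQuasiInfinitelyDivisible {E : Type*} [NormedAddCommGroup E] [InnerProductSpace ℝ E]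
    [MeasurableSpace E] (μ : Measure E) : Prop :=
  IsProbabilityMeasure μ ∧
    ∃ μ₁ μ₂ : Measure E, IsInfinitelyDivisible μ₁ ∧ IsInfinitelyDivisible μ₂ ∧
      ∀ z : E, charFun μ z = charFun μ₁ z / charFun μ₂ z

/-- The Borel sets that are bounded away from zero. -/
def AwaySet (E : Type*) [NormedAddCommGroup E] [MeasurableSpace E] : Type _ :=
  {B : Set E // MeasurableSet B ∧ ∃ r : ℝ, 0 < r ∧ ∀ x ∈ B, r ≤ ‖x‖}

/-- Real-valued functions on the Borel sets bounded away from zero whose restriction to the Borel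
subsets of `{x | r ≤ ‖x‖}` is a finite signed measure for every `r > 0`. -/
@[ext]
structure AwaySignedMeasure (E : Type*) [NormedAddCommGroup E] [MeasurableSpace E] where
  /-- The underlying set function. -/
  toFun : AwaySet E → ℝ
  /-- `σ`-additivity on the Borel subsets of `{x | r ≤ ‖x‖}`; with `f n = ∅` it gives
  that the empty set has value `0`. -/
  hasSum' : ∀ r : ℝ, 0 < r → ∀ f : ℕ → AwaySet E, (∀ n, ∀ x ∈ (f n).1, r ≤ ‖x‖) →
    Pairwise (Disjoint on fun n => (f n).1) →
    ∀ B : AwaySet E, B.1 = ⋃ n, (f n).1 → HasSum (fun n => toFun (f n)) (toFun B)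

namespace AwaySignedMeasure

section general

variable {E : Type*} [NormedAddCommGroup E] [MeasurableSpace E] [BorelSpace E]

theorem measurableSet_far (r : ℝ) : MeasurableSet {x : E | r ≤ ‖x‖} :=
  (isClosed_le continuous_const continuous_norm).measurableSet

/-- The part of a Borel set outside the open ball of radius `r` around zero. -/
def farPart (r : ℝ) (hr : 0 < r) (B : Set E) (hB : MeasurableSet B) : AwaySet E :=
  ⟨B ∩ {x | r ≤ ‖x‖}, hB.inter (measurableSet_far r), r, hr, fun _ hx => hx.2⟩

theorem map_empty (ν : AwaySignedMeasure E) (B : AwaySet E) (hB : B.1 = ∅) : ν.toFun B = 0 := by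
  have h := ν.hasSum' 1 one_pos (fun _ => B) (by simp [hB])
    (fun i j _ => by simp [Function.onFun, hB]) B (by simp [hB])
  exact (summable_const_iff _).1 h.summable

open Classical in
/-- The finite signed measure `B ↦ ν (B ∩ {x | r ≤ ‖x‖})`, that is, the restriction of `ν` to
the Borel subsets of `{x | r ≤ ‖x‖}`, extended by zero to all Borel sets. -/
def truncation (ν : AwaySignedMeasure E) (r : ℝ) (hr : 0 < r) : SignedMeasure E where
  measureOf' B := if hB : MeasurableSet B then ν.toFun (farPart r hr B hB) else 0
  empty' := by
    rw [dif_pos MeasurableSet.empty]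
    exact ν.map_empty _ (Set.empty_inter _)
  not_measurable' _ hB := dif_neg hB
  m_iUnion' f hf hd := by
    simp only [dif_pos (hf _), dif_pos (MeasurableSet.iUnion hf)]
    refine ν.hasSum' r hr (fun n => farPart r hr (f n) (hf n)) (fun n x hx => hx.2) ?_ _ ?_
    · intro i j hij
      exact (hd hij).mono Set.inter_subset_left Set.inter_subset_left
    · exact Set.iUnion_inter _ _

theorem truncation_apply (ν : AwaySignedMeasure E) (r : ℝ) (hr : 0 < r) {B : Set E}
    (hB : MeasurableSet B) : ν.truncation r hr B = ν.toFun (farPart r hr B hB) :=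
  dif_pos hB

/-- The shells `{x | 1 / (n + 1) < ‖x‖ ≤ 1 / n}` (with `1 / 0 = ∞`); they partition `E \ {0}`. -/
def shell (E : Type*) [NormedAddCommGroup E] (n : ℕ) : Set E :=
  {x | x ≠ 0 ∧ ⌊‖x‖⁻¹⌋₊ = n}

/-- The positive part of `ν`, a Borel measure on `E`, glued from the Jordan decompositions of the
truncations of `ν`; see `posPart_zero` and `posPart_apply`. -/
def posPart (ν : AwaySignedMeasure E) : Measure E :=
  Measure.sum fun n : ℕ =>
    (ν.truncation (1 / ((n : ℝ) + 1)) (by positivity)).toJordanDecomposition.posPart.restrict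
      (shell E n)

/-- The negative part of `ν`; see `negPart_zero` and `negPart_apply`. -/
def negPart (ν : AwaySignedMeasure E) : Measure E :=
  Measure.sum fun n : ℕ =>
    (ν.truncation (1 / ((n : ℝ) + 1)) (by positivity)).toJordanDecomposition.negPart.restrict
      (shell E n)

theorem measurableSet_shell (n : ℕ) : MeasurableSet (shell E n) := by
  have h1 : MeasurableSet {x : E | x ≠ 0} := (isClosed_singleton (x := (0 : E))).measurableSet.compl
  have h2 : Measurable fun x : E => ⌊‖x‖⁻¹⌋₊ := Nat.measurable_floor.comp measurable_norm.inv
  exact h1.inter (h2 (measurableSet_singleton n))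

theorem shell_far {n : ℕ} {x : E} (hx : x ∈ shell E n) : 1 / ((n : ℝ) + 1) ≤ ‖x‖ := by
  have h1 : 0 < ‖x‖ := norm_pos_iff.2 hx.1
  have h2 : ‖x‖⁻¹ < (n : ℝ) + 1 := by
    have := Nat.lt_floor_add_one ‖x‖⁻¹
    rwa [hx.2] at this
  rw [div_le_iff₀ (by positivity)]
  have := mul_lt_mul_of_pos_left h2 h1
  rw [mul_inv_cancel₀ h1.ne'] at this
  exact this.le

theorem jordan_restrict (s : SignedMeasure E) {i : Set E} (hi : MeasurableSet i) :
    (SignedMeasure.toJordanDecomposition (s.restrict i)).posPart = s.toJordanDecomposition.posPart.restrict i ∧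
    (SignedMeasure.toJordanDecomposition (s.restrict i)).negPart = s.toJordanDecomposition.negPart.restrict i := by
  let j : JordanDecomposition E :=
    { posPart := s.toJordanDecomposition.posPart.restrict i
      negPart := s.toJordanDecomposition.negPart.restrict i
      mutuallySingular := (s.toJordanDecomposition.mutuallySingular.restrict i).symm.restrict i
        |>.symm }
  have h : (SignedMeasure.toJordanDecomposition (s.restrict i)) = j := by
    refine SignedMeasure.toJordanDecomposition_eq ?_
    ext B hB
    rw [VectorMeasure.restrict_apply _ hi hB,
      SignedMeasure.apply_eq_posPart_real_sub_negPart_real s (hB.inter hi),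
      JordanDecomposition.toSignedMeasure, Measure.toSignedMeasure_sub_apply hB]
    simp [j, measureReal_restrict_apply hB]
  rw [h]
  exact ⟨rfl, rfl⟩

theorem truncation_restrict (ν : AwaySignedMeasure E) {r s : ℝ} (hr : 0 < r) (hs : 0 < s) :
    (ν.truncation r hr).restrict {x | s ≤ ‖x‖} = (ν.truncation s hs).restrict {x | r ≤ ‖x‖} := by
  ext B hB
  rw [VectorMeasure.restrict_apply _ (measurableSet_far s) hB,
    VectorMeasure.restrict_apply _ (measurableSet_far r) hB,
    truncation_apply _ _ _ (hB.inter (measurableSet_far s)),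
    truncation_apply _ _ _ (hB.inter (measurableSet_far r))]
  congr 1
  exact Subtype.ext (Set.inter_right_comm _ _ _)

theorem jordan_truncation (ν : AwaySignedMeasure E) {r s : ℝ} (hr : 0 < r) (hs : 0 < s) {B : Set E}
    (hrB : ∀ x ∈ B, r ≤ ‖x‖) (hsB : ∀ x ∈ B, s ≤ ‖x‖) :
    (ν.truncation r hr).toJordanDecomposition.posPart B =
      (ν.truncation s hs).toJordanDecomposition.posPart B ∧
    (ν.truncation r hr).toJordanDecomposition.negPart B =
      (ν.truncation s hs).toJordanDecomposition.negPart B := by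
  have h1 := jordan_restrict (ν.truncation r hr) (measurableSet_far s)
  have h2 := jordan_restrict (ν.truncation s hs) (measurableSet_far r)
  have hr' : B ⊆ {x | r ≤ ‖x‖} := fun x hx => hrB x hx
  have hs' : B ⊆ {x | s ≤ ‖x‖} := fun x hx => hsB x hx
  rw [ν.truncation_restrict hr hs] at h1
  constructor
  · have := congrArg (fun m : Measure E => m B) (h1.1.symm.trans h2.1)
    simpa [Measure.restrict_eq_self _ hr', Measure.restrict_eq_self _ hs'] using this
  · have := congrArg (fun m : Measure E => m B) (h1.2.symm.trans h2.2)
    simpa [Measure.restrict_eq_self _ hr', Measure.restrict_eq_self _ hs'] using this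

theorem tsum_shell (m : Measure E) {B : Set E} (hB : MeasurableSet B) {r : ℝ} (hr : 0 < r)
    (hrB : ∀ x ∈ B, r ≤ ‖x‖) : ∑' n, m (B ∩ shell E n) = m B := by
  rw [← measure_iUnion]
  · congr 1
    ext x
    simp only [Set.mem_iUnion, Set.mem_inter_iff, shell, Set.mem_ofPred_eq]
    constructor
    · rintro ⟨n, h, -⟩
      exact h
    · intro h
      exact ⟨_, h, norm_pos_iff.1 (hr.trans_le (hrB x h)), rfl⟩
  · intro i j hij
    refine Set.disjoint_left.2 fun x hx hy => hij ?_
    rw [← hx.2.2, ← hy.2.2]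
  · exact fun n => hB.inter (measurableSet_shell n)

theorem posPart_zero (ν : AwaySignedMeasure E) : ν.posPart {0} = 0 := by
  rw [posPart, Measure.sum_apply _ (measurableSet_singleton 0)]
  refine ENNReal.tsum_eq_zero.2 fun n => ?_
  rw [Measure.restrict_apply (measurableSet_singleton 0),
    show ({0} : Set E) ∩ shell E n = ∅ by ext x; simp [shell], measure_empty]

theorem negPart_zero (ν : AwaySignedMeasure E) : ν.negPart {0} = 0 := by
  rw [negPart, Measure.sum_apply _ (measurableSet_singleton 0)]
  refine ENNReal.tsum_eq_zero.2 fun n => ?_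
  rw [Measure.restrict_apply (measurableSet_singleton 0),
    show ({0} : Set E) ∩ shell E n = ∅ by ext x; simp [shell], measure_empty]

/-- On the Borel subsets of `{x | r ≤ ‖x‖}`, the positive part of `ν` is the positive part of the
signed measure to which `ν` restricts there. -/
theorem posPart_apply (ν : AwaySignedMeasure E) {r : ℝ} (hr : 0 < r) {B : Set E}
    (hB : MeasurableSet B) (hrB : ∀ x ∈ B, r ≤ ‖x‖) :
    ν.posPart B = (ν.truncation r hr).toJordanDecomposition.posPart B := by
  rw [posPart, Measure.sum_apply _ hB, ← tsum_shell _ hB hr hrB]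
  refine tsum_congr fun n => ?_
  rw [Measure.restrict_apply hB]
  exact (ν.jordan_truncation _ _ (fun x hx => shell_far hx.2) (fun x hx => hrB x hx.1)).1

/-- On the Borel subsets of `{x | r ≤ ‖x‖}`, the negative part of `ν` is the negative part of the
signed measure to which `ν` restricts there. -/
theorem negPart_apply (ν : AwaySignedMeasure E) {r : ℝ} (hr : 0 < r) {B : Set E}
    (hB : MeasurableSet B) (hrB : ∀ x ∈ B, r ≤ ‖x‖) :
    ν.negPart B = (ν.truncation r hr).toJordanDecomposition.negPart B := by
  rw [negPart, Measure.sum_apply _ hB, ← tsum_shell _ hB hr hrB]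
  refine tsum_congr fun n => ?_
  rw [Measure.restrict_apply hB]
  exact (ν.jordan_truncation _ _ (fun x hx => shell_far hx.2) (fun x hx => hrB x hx.1)).2

/-- The integral with respect to `ν`, for functions integrable with respect to both parts. -/
def integral (ν : AwaySignedMeasure E) (f : E → ℂ) : ℂ :=
  ∫ x, f x ∂ν.posPart - ∫ x, f x ∂ν.negPart

/-- `ν` is a quasi-Lévy type measure if `x ↦ 1 ∧ |x|²` is integrable with respect to `ν`. -/
def IsQuasiLevyType (ν : AwaySignedMeasure E) : Prop :=
  Integrable (fun x : E => min 1 (‖x‖ ^ 2)) ν.posPart ∧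
    Integrable (fun x : E => min 1 (‖x‖ ^ 2)) ν.negPart

end general

/-- The section of `B` along the `k`-th coordinate axis: the reals `x` with
`(0, …, 0, x, 0, …, 0) ∈ B`, where `x` is in position `k`. -/
def axisSection {d : ℕ} (k : Fin d) (B : AwaySet (EuclideanSpace ℝ (Fin d))) : AwaySet ℝ :=
  ⟨{x : ℝ | EuclideanSpace.single k x ∈ B.1}, by
    obtain ⟨B, hB, r, hr, hrB⟩ := B
    refine ⟨?_, r, hr, fun x hx => by simpa using hrB _ hx⟩
    have : Measurable fun x : ℝ => (EuclideanSpace.single k x : EuclideanSpace ℝ (Fin d)) :=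
      (Isometry.of_dist_eq fun x y => PiLp.dist_single_same 2 (fun _ => ℝ) k x y).continuous.measurable
    exact this hB⟩

/-- The product `δ₀ ⊗ ⋯ ⊗ δ₀ ⊗ ν ⊗ δ₀ ⊗ ⋯ ⊗ δ₀` with `ν` in position `k`, that is, `ν` placed
on the `k`-th coordinate axis of `ℝᵈ`. -/
def onAxis {d : ℕ} (k : Fin d) (ν : AwaySignedMeasure ℝ) :
    AwaySignedMeasure (EuclideanSpace ℝ (Fin d)) where
  toFun B := ν.toFun (axisSection k B)
  hasSum' r hr f hf hd B hB := by
    refine ν.hasSum' r hr (fun n => axisSection k (f n)) (fun n x hx => ?_) ?_ _ ?_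
    · simpa using hf n _ hx
    · intro i j hij
      refine Set.disjoint_left.2 fun x hx hy => ?_
      exact Set.disjoint_left.1 (hd hij) hx hy
    · ext x
      simp [axisSection, hB]

end AwaySignedMeasure

/-- `(A, ν, γ)` is a (standard) characteristic triplet of `μ`: `A` is symmetric, `ν` is a quasi-Lévy
type measure, and the characteristic function of `μ` has the Lévy-Khintchine type representation
given by `(A, ν, γ)` and the standard representation function `x ↦ x 1_{[0,1]}(|x|)`.
A symmetric matrix enters as the linear map that it induces. -/
def IsCharTriplet {E : Type*} [NormedAddCommGroup E] [InnerProductSpace ℝ E] [MeasurableSpace E]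
    [BorelSpace E] (μ : Measure E) (A : E →ₗ[ℝ] E) (ν : AwaySignedMeasure E) (γ : E) : Prop :=
  A.IsSymmetric ∧ ν.IsQuasiLevyType ∧
    ∀ z : E, charFun μ z =
      Complex.exp (Complex.I * (⟪γ, z⟫ : ℝ) - 1 / 2 * (⟪z, A z⟫ : ℝ) +
        ν.integral fun x => Complex.exp (Complex.I * (⟪z, x⟫ : ℝ)) - 1 -
          Complex.I * ((⟪z, x⟫ * Set.indicator (Set.Icc 0 1) 1 ‖x‖ : ℝ) : ℂ))

end

/-! Independence means that the characteristic function of the vector is the product of those of its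
coordinates. Coordinate projections and products preserve infinite divisibility, hence also
quotients of characteristic functions of such laws; this is the equivalence.

Triplets exist on `ℝ` because both laws in the quotient have a Lévy-Khintchine representation
(`IsInfinitelyDivisible.exists_levyKhintchine`), and dividing subtracts exponents. Multiplying over
the coordinates adds exponents, which places the one-dimensional data on the axes
(`IsCharTriplet.pi`). The formulas for an arbitrary triplet then follow from uniqueness
(`IsCharTriplet.unique`).

Uniqueness and Lévy-Khintchine rest on one device, the second difference `2ψ(z) - ψ(z+h) - ψ(z-h)`
of an exponent. It kills the drift, turns the Gaussian part into the constant `⟨h, Ah⟩`, and turns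
the jump part into the Fourier transform of the measure `2(1 - cos⟨h,x⟩) ν(dx)`, which has finite
parts. A constant is the Fourier transform of a point mass at `0`, so off `0` the exponent
determines all these measures and thus `ν`.

Conversely, the logarithm `ψ` of an infinitely divisible characteristic function is the limit of
`n(exp(ψ/n) - 1)`, so by Lévy's continuity theorem its second differences are Fourier transforms of
finite measures `G h`. These are compatible and glue to a Lévy measure. Removing its contribution
from `ψ` leaves a function with constant second differences, that is, drift plus Gaussian part. -/

section LevyMeasure

/-! ### Lévy measures and their differences. -/

variable {E : Type*} [NormedAddCommGroup E] [MeasurableSpace E]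

/-- A Lévy measure: no mass at zero, and `1 ∧ |x|²` is integrable. -/
structure IsLevyMeasure (m : Measure E) : Prop where
  zero : m {0} = 0
  integrable : Integrable (fun x : E => min 1 (‖x‖ ^ 2)) m

theorem IsLevyMeasure.add {m m' : Measure E} (h : IsLevyMeasure m) (h' : IsLevyMeasure m') :
    IsLevyMeasure (m + m') :=
  ⟨by simp [h.zero, h'.zero], h.integrable.add_measure h'.integrable⟩

theorem IsLevyMeasure.finsetSum {ι : Type*} (s : Finset ι) {m : ι → Measure E}
    (h : ∀ i, IsLevyMeasure (m i)) : IsLevyMeasure (∑ i ∈ s, m i) :=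
  ⟨by simp [Measure.finsetSum_apply, (h _).zero],
    integrable_finsetSum_measure.2 fun i _ => (h i).integrable⟩

theorem IsLevyMeasure.lt_top {m : Measure E} (h : IsLevyMeasure m) {B : Set E} {r : ℝ}
    (hr : 0 < r) (hB : ∀ x ∈ B, r ≤ ‖x‖) : m B < ⊤ := by
  have hc : 0 < min 1 (r ^ 2) := lt_min one_pos (by positivity)
  refine (measure_mono fun x hx => ?_).trans_lt (h.integrable.measure_ge_lt_top hc)
  exact min_le_min_left _ (pow_le_pow_left₀ hr.le (hB x hx) 2)

namespace AwaySignedMeasure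

/-- `ν` is the difference of the measures `m₁` and `m₂` on the sets bounded away from zero. -/
def IsDiff (ν : AwaySignedMeasure E) (m₁ m₂ : Measure E) : Prop :=
  ∀ B : AwaySet E, ν.toFun B = m₁.real B.1 - m₂.real B.1

/-- The difference of two Lévy measures. -/
def ofDiff {m₁ m₂ : Measure E} (h₁ : IsLevyMeasure m₁) (h₂ : IsLevyMeasure m₂) :
    AwaySignedMeasure E where
  toFun B := m₁.real B.1 - m₂.real B.1
  hasSum' r hr f hf hd B hB := by
    have key : ∀ m : Measure E, IsLevyMeasure m → HasSum (fun n => m.real (f n).1) (m.real B.1) := by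
      intro m hm
      have hfin : m (⋃ n, (f n).1) ≠ ⊤ := (hm.lt_top hr (by
        intro x hx
        obtain ⟨n, hn⟩ := Set.mem_iUnion.1 hx
        exact hf n x hn)).ne
      have h1 := measure_iUnion (μ := m) hd fun n => (f n).2.1
      have h2 := ENNReal.hasSum_toReal (h1 ▸ hfin)
      rw [← ENNReal.tsum_toReal_eq (ENNReal.ne_top_of_tsum_ne_top (h1 ▸ hfin)), ← h1] at h2
      simpa [Measure.real, hB] using h2
    exact (key m₁ h₁).sub (key m₂ h₂)

theorem isDiff_ofDiff {m₁ m₂ : Measure E} (h₁ : IsLevyMeasure m₁) (h₂ : IsLevyMeasure m₂) :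
    (ofDiff h₁ h₂).IsDiff m₁ m₂ :=
  fun _ => rfl

variable {ν : AwaySignedMeasure E} {m₁ m₂ m₁' m₂' : Measure E}

/-- The hypothesis is additive because the measures may be infinite near zero, where a difference
has no meaning. -/
theorem IsDiff.ext {ν' : AwaySignedMeasure E} (h : ν.IsDiff m₁ m₂) (h' : ν'.IsDiff m₁' m₂')
    (h₁ : IsLevyMeasure m₁) (h₂ : IsLevyMeasure m₂) (h₁' : IsLevyMeasure m₁')
    (h₂' : IsLevyMeasure m₂') (H : m₁ + m₂' = m₁' + m₂) : ν = ν' := by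
  ext B
  obtain ⟨r, hr, hrB⟩ := B.2.2
  have e := congrArg (fun m : Measure E => (m B.1).toReal) H
  simp only [Measure.add_apply] at e
  rw [ENNReal.toReal_add (h₁.lt_top hr hrB).ne (h₂'.lt_top hr hrB).ne,
    ENNReal.toReal_add (h₁'.lt_top hr hrB).ne (h₂.lt_top hr hrB).ne] at e
  rw [h B, h' B]
  simp only [Measure.real]
  linarith

end AwaySignedMeasure

variable [BorelSpace E]

open AwaySignedMeasure

theorem measure_eq_tsum_shell {m : Measure E} (h : m {0} = 0) {B : Set E} (hB : MeasurableSet B) :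
    m B = ∑' n, m (B ∩ shell E n) := by
  rw [← measure_iUnion]
  · have : (⋃ n, B ∩ shell E n) = B \ {0} := by
      ext x
      simp [shell]
    rw [this, measure_sdiff_null h]
  · intro i j hij
    refine Set.disjoint_left.2 fun x hx hy => hij ?_
    rw [← hx.2.2, ← hy.2.2]
  · exact fun n => hB.inter (measurableSet_shell n)

/-- The shells are bounded away from zero and exhaust the complement of `0`. -/
theorem ext_of_away {m m' : Measure E} (h : m {0} = 0) (h' : m' {0} = 0)
    (H : ∀ B : AwaySet E, m B.1 = m' B.1) : m = m' := by
  ext B hB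
  rw [measure_eq_tsum_shell h hB, measure_eq_tsum_shell h' hB]
  exact tsum_congr fun n => H ⟨_, hB.inter (measurableSet_shell n), 1 / ((n : ℝ) + 1),
    by positivity, fun x hx => shell_far hx.2⟩

namespace AwaySignedMeasure

theorem isDiff_posPart_negPart (ν : AwaySignedMeasure E) : ν.IsDiff ν.posPart ν.negPart := by
  rintro ⟨B, hB, r, hr, hrB⟩
  have h := SignedMeasure.apply_eq_posPart_real_sub_negPart_real (ν.truncation r hr) hB
  rw [truncation_apply _ _ _ hB] at h
  rw [Measure.real, Measure.real, posPart_apply ν hr hB hrB, negPart_apply ν hr hB hrB]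
  rw [Measure.real, Measure.real] at h
  rw [← h]
  congr 1
  exact Subtype.ext (Set.inter_eq_left.2 hrB).symm

variable {ν : AwaySignedMeasure E} {m₁ m₂ m₁' m₂' : Measure E}

theorem IsQuasiLevyType.isLevyMeasure_posPart (h : ν.IsQuasiLevyType) :
    IsLevyMeasure ν.posPart :=
  ⟨ν.posPart_zero, h.1⟩

theorem IsQuasiLevyType.isLevyMeasure_negPart (h : ν.IsQuasiLevyType) :
    IsLevyMeasure ν.negPart :=
  ⟨ν.negPart_zero, h.2⟩

theorem IsDiff.add_eq_add (h : ν.IsDiff m₁ m₂) (h' : ν.IsDiff m₁' m₂') (h₁ : IsLevyMeasure m₁)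
    (h₂ : IsLevyMeasure m₂) (h₁' : IsLevyMeasure m₁') (h₂' : IsLevyMeasure m₂') :
    m₁ + m₂' = m₁' + m₂ := by
  refine ext_of_away (h₁.add h₂').zero (h₁'.add h₂).zero fun B => ?_
  obtain ⟨r, hr, hrB⟩ := B.2.2
  have e := (h B).symm.trans (h' B)
  rw [← ENNReal.toReal_eq_toReal_iff' ((h₁.add h₂').lt_top hr hrB).ne
    ((h₁'.add h₂).lt_top hr hrB).ne, Measure.add_apply, Measure.add_apply,
    ENNReal.toReal_add (h₁.lt_top hr hrB).ne (h₂'.lt_top hr hrB).ne,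
    ENNReal.toReal_add (h₁'.lt_top hr hrB).ne (h₂.lt_top hr hrB).ne]
  simp only [Measure.real] at e
  linarith

/-- Minimality of the Jordan decomposition: with `i` the positive Hahn set, the positive part of `B`
is `m₁ (i ∩ B) - m₂ (i ∩ B)`, at most `m₁ B`; likewise on `iᶜ`. -/
theorem IsDiff.jordan_truncation_le (h : ν.IsDiff m₁ m₂) (h₁ : IsLevyMeasure m₁)
    (h₂ : IsLevyMeasure m₂) {r : ℝ} (hr : 0 < r) {B : Set E} (hB : MeasurableSet B)
    (hrB : ∀ x ∈ B, r ≤ ‖x‖) :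
    (ν.truncation r hr).toJordanDecomposition.posPart B ≤ m₁ B ∧
      (ν.truncation r hr).toJordanDecomposition.negPart B ≤ m₂ B := by
  have key : ∀ i : Set E, MeasurableSet i →
      (ν.truncation r hr) (i ∩ B) = m₁.real (i ∩ B) - m₂.real (i ∩ B) := by
    intro i hi
    rw [truncation_apply _ _ _ (hi.inter hB), h]
    have : (farPart r hr (i ∩ B) (hi.inter hB)).1 = i ∩ B :=
      Set.inter_eq_left.2 fun x hx => hrB x hx.2
    rw [this]
  obtain ⟨i, hi₁, hi₂, hi₃, hp, hn⟩ := (ν.truncation r hr).toJordanDecomposition_spec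
  have hle : ∀ (m : Measure E) (i : Set E), IsLevyMeasure m → m.real (i ∩ B) ≤ m.real B :=
    fun m i hm => measureReal_mono Set.inter_subset_right (hm.lt_top hr hrB).ne
  constructor
  · rw [← ENNReal.toReal_le_toReal (measure_ne_top _ _) (h₁.lt_top hr hrB).ne]
    change Measure.real _ _ ≤ Measure.real _ _
    rw [hp, SignedMeasure.toMeasureOfZeroLE_real_apply _ hi₂ hi₁ hB, key i hi₁]
    have := hle m₁ i h₁
    have : 0 ≤ m₂.real (i ∩ B) := measureReal_nonneg
    linarith
  · rw [← ENNReal.toReal_le_toReal (measure_ne_top _ _) (h₂.lt_top hr hrB).ne]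
    change Measure.real _ _ ≤ Measure.real _ _
    rw [hn, SignedMeasure.toMeasureOfLEZero_real_apply _ hi₃ hi₁.compl hB, key _ hi₁.compl]
    have := hle m₂ iᶜ h₂
    have : 0 ≤ m₁.real (iᶜ ∩ B) := measureReal_nonneg
    linarith

theorem IsDiff.posPart_le (h : ν.IsDiff m₁ m₂) (h₁ : IsLevyMeasure m₁)
    (h₂ : IsLevyMeasure m₂) : ν.posPart ≤ m₁ := by
  refine Measure.le_iff.2 fun B hB => ?_
  rw [posPart, Measure.sum_apply _ hB, measure_eq_tsum_shell h₁.zero hB]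
  refine ENNReal.tsum_le_tsum fun n => ?_
  rw [Measure.restrict_apply hB]
  exact (h.jordan_truncation_le h₁ h₂ _ (hB.inter (measurableSet_shell n))
    fun x hx => shell_far hx.2).1

theorem IsDiff.negPart_le (h : ν.IsDiff m₁ m₂) (h₁ : IsLevyMeasure m₁)
    (h₂ : IsLevyMeasure m₂) : ν.negPart ≤ m₂ := by
  refine Measure.le_iff.2 fun B hB => ?_
  rw [negPart, Measure.sum_apply _ hB, measure_eq_tsum_shell h₂.zero hB]
  refine ENNReal.tsum_le_tsum fun n => ?_
  rw [Measure.restrict_apply hB]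
  exact (h.jordan_truncation_le h₁ h₂ _ (hB.inter (measurableSet_shell n))
    fun x hx => shell_far hx.2).2

theorem IsDiff.isQuasiLevyType (h : ν.IsDiff m₁ m₂) (h₁ : IsLevyMeasure m₁)
    (h₂ : IsLevyMeasure m₂) : ν.IsQuasiLevyType :=
  ⟨h₁.integrable.mono_measure (h.posPart_le h₁ h₂),
    h₂.integrable.mono_measure (h.negPart_le h₁ h₂)⟩

/-- Integrals can be computed from any representation as a difference, so the Jordan parts never
have to be identified: integrate `ν.posPart + m₂ = m₁ + ν.negPart`. -/
theorem IsDiff.integral_eq (h : ν.IsDiff m₁ m₂) (h₁ : IsLevyMeasure m₁)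
    (h₂ : IsLevyMeasure m₂) {f : E → ℂ} (hf₁ : Integrable f m₁) (hf₂ : Integrable f m₂) :
    ν.integral f = ∫ x, f x ∂m₁ - ∫ x, f x ∂m₂ := by
  have hν := h.isQuasiLevyType h₁ h₂
  have e := ν.isDiff_posPart_negPart.add_eq_add h hν.isLevyMeasure_posPart
    hν.isLevyMeasure_negPart h₁ h₂
  have e' := congrArg (fun m => ∫ x, f x ∂m) e
  rw [integral_add_measure (hf₁.mono_measure (h.posPart_le h₁ h₂)) hf₂,
    integral_add_measure hf₁ (hf₂.mono_measure (h.negPart_le h₁ h₂))] at e'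
  rw [AwaySignedMeasure.integral]
  linear_combination e'

end AwaySignedMeasure

end LevyMeasure

/-! ### The Lévy-Khintchine integrand and its second differences. -/

section LevyKernel

open Complex Filter Topology

variable {E : Type*} [NormedAddCommGroup E] [InnerProductSpace ℝ E]

/-- The integrand of the Lévy-Khintchine representation. -/
noncomputable def levyKernel (z x : E) : ℂ :=
  exp (I * (⟪z, x⟫ : ℝ)) - 1 - I * ((⟪z, x⟫ * Set.indicator (Set.Icc 0 1) 1 ‖x‖ : ℝ) : ℂ)

/-- Taylor gives `u ^ 2` for `|u| ≤ 1`; otherwise the trivial bound `2 + |u|` is at most `3 * u ^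
2`. -/
theorem norm_exp_I_mul_sub_one_sub_le (u : ℝ) : ‖exp (I * u) - 1 - I * u‖ ≤ 3 * u ^ 2 := by
  rcases le_total |u| 1 with h | h
  · have hn : ‖I * (u : ℂ)‖ = |u| := by simp
    have := norm_exp_sub_one_sub_id_le (x := I * u) (by rwa [hn])
    rw [hn, sq_abs] at this
    nlinarith [sq_nonneg u]
  · have h1 : ‖exp (I * u) - 1 - I * u‖ ≤ ‖exp (I * u)‖ + 1 + |u| := by
      refine (norm_sub_le _ _).trans ?_
      gcongr
      · exact (norm_sub_le _ _).trans (by simp)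
      · simp
    rw [norm_exp_I_mul_ofReal] at h1
    have h2 : |u| ≤ u ^ 2 := by rw [← sq_abs]; nlinarith
    linarith

theorem norm_levyKernel_le (z x : E) :
    ‖levyKernel z x‖ ≤ (2 + 3 * ‖z‖ ^ 2) * min 1 (‖x‖ ^ 2) := by
  have hz : 0 ≤ 3 * ‖z‖ ^ 2 := by positivity
  rcases le_or_gt ‖x‖ 1 with h | h
  · have hx : ‖x‖ ^ 2 ≤ 1 := pow_le_one₀ (norm_nonneg _) h
    have hi : Set.indicator (Set.Icc (0 : ℝ) 1) (1 : ℝ → ℝ) ‖x‖ = 1 :=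
      Set.indicator_of_mem (show ‖x‖ ∈ Set.Icc (0 : ℝ) 1 from ⟨norm_nonneg _, h⟩) _
    rw [levyKernel, hi, mul_one, min_eq_right hx]
    refine (norm_exp_I_mul_sub_one_sub_le _).trans ?_
    have h1 : (⟪z, x⟫ : ℝ) ^ 2 ≤ ‖z‖ ^ 2 * ‖x‖ ^ 2 := by
      rw [← sq_abs, ← mul_pow]
      exact pow_le_pow_left₀ (abs_nonneg _) (abs_real_inner_le_norm z x) 2
    nlinarith [sq_nonneg ‖x‖]
  · have hx : 1 ≤ ‖x‖ ^ 2 := one_le_pow₀ h.le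
    have hi : Set.indicator (Set.Icc (0 : ℝ) 1) (1 : ℝ → ℝ) ‖x‖ = 0 :=
      Set.indicator_of_notMem (fun hh => h.not_ge hh.2) _
    rw [levyKernel, hi, mul_zero, min_eq_left hx]
    have : ‖exp (I * (⟪z, x⟫ : ℝ)) - 1 - I * ((0 : ℝ) : ℂ)‖ ≤ 1 + 1 := by
      rw [ofReal_zero, mul_zero, sub_zero]
      exact (norm_sub_le _ _).trans (by rw [norm_exp_I_mul_ofReal]; simp)
    linarith

theorem continuous_levyKernel_left (x : E) : Continuous fun z : E => levyKernel z x := by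
  unfold levyKernel
  fun_prop

theorem levyKernel_zero_left (x : E) : levyKernel 0 x = 0 := by
  simp [levyKernel]

/-- The compensator is affine in `z` and drops out, leaving a nonnegative density times a character.
-/
theorem levyKernel_second_difference (z h x : E) :
    2 * levyKernel z x - levyKernel (z + h) x - levyKernel (z - h) x =
      exp (⟪x, z⟫ * I) * ((2 * (1 - Real.cos ⟪h, x⟫) : ℝ) : ℂ) := by
  have e1 : exp (I * ((⟪z, x⟫ + ⟪h, x⟫ : ℝ) : ℂ)) =
      exp (⟪z, x⟫ * I) * (Complex.cos (⟪h, x⟫ : ℝ) + Complex.sin (⟪h, x⟫ : ℝ) * I) := by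
    rw [← exp_mul_I, ← exp_add]; push_cast; ring_nf
  have e2 : exp (I * ((⟪z, x⟫ - ⟪h, x⟫ : ℝ) : ℂ)) =
      exp (⟪z, x⟫ * I) * (Complex.cos (⟪h, x⟫ : ℝ) - Complex.sin (⟪h, x⟫ : ℝ) * I) := by
    have := exp_mul_I (-((⟪h, x⟫ : ℝ) : ℂ))
    simp only [Complex.cos_neg, Complex.sin_neg, neg_mul, ← sub_eq_add_neg] at this
    rw [← this, ← exp_add]; push_cast; ring_nf
  simp only [levyKernel, inner_add_left, inner_sub_left, e1, e2, real_inner_comm z x]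
  rw [mul_comm I]
  push_cast
  ring

variable [MeasurableSpace E]

/-- The measure with density `2 (1 - cos ⟨h, x⟩)`, whose characteristic function is a second
difference of the Lévy exponent. -/
noncomputable def cosMeasure (h : E) (m : Measure E) : Measure E :=
  m.withDensity fun x => ENNReal.ofReal (2 * (1 - Real.cos ⟪h, x⟫))

theorem cosMeasure_add (h : E) (m m' : Measure E) :
    cosMeasure h (m + m') = cosMeasure h m + cosMeasure h m' :=
  withDensity_add_measure _ _ _

variable [BorelSpace E]

theorem measurable_levyKernel_right (z : E) : Measurable (levyKernel z) := by
  have h1 : Measurable fun x : E => ⟪z, x⟫ := by fun_prop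
  have h2 : Measurable fun x : E => Set.indicator (Set.Icc (0 : ℝ) 1) (1 : ℝ → ℝ) ‖x‖ :=
    (measurable_one.indicator measurableSet_Icc).comp measurable_norm
  have h3 : Measurable fun x : E =>
      ((⟪z, x⟫ * Set.indicator (Set.Icc (0 : ℝ) 1) (1 : ℝ → ℝ) ‖x‖ : ℝ) : ℂ) :=
    measurable_ofReal.comp (h1.mul h2)
  unfold levyKernel
  exact (by fun_prop : Measurable fun x : E => exp (I * (⟪z, x⟫ : ℝ)) - 1).sub (h3.const_mul I)

variable {m : Measure E}

theorem IsLevyMeasure.integrable_levyKernel (hm : IsLevyMeasure m) (z : E) :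
    Integrable (levyKernel z) m :=
  (hm.integrable.const_mul (2 + 3 * ‖z‖ ^ 2)).mono'
    (measurable_levyKernel_right z).aestronglyMeasurable
    (ae_of_all _ fun x => norm_levyKernel_le z x)

theorem IsLevyMeasure.continuous_integral_levyKernel (hm : IsLevyMeasure m) :
    Continuous fun z => ∫ x, levyKernel z x ∂m := by
  refine continuous_iff_continuousAt.2 fun z₀ => ?_
  refine continuousAt_of_dominated (bound := fun x => (2 + 3 * (‖z₀‖ + 1) ^ 2) * min 1 (‖x‖ ^ 2))
    (Eventually.of_forall fun z => (measurable_levyKernel_right z).aestronglyMeasurable) ?_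
    (hm.integrable.const_mul _)
    (ae_of_all _ fun x => (continuous_levyKernel_left x).continuousAt)
  have : ∀ᶠ z in 𝓝 z₀, ‖z‖ < ‖z₀‖ + 1 :=
    continuous_norm.continuousAt.eventually_lt_const (lt_add_one _)
  filter_upwards [this] with z hz
  refine ae_of_all _ fun x => (norm_levyKernel_le z x).trans ?_
  gcongr

theorem measurable_cosDensity (h : E) :
    Measurable fun x : E => ENNReal.ofReal (2 * (1 - Real.cos ⟪h, x⟫)) := by
  fun_prop

theorem cosDensity_nonneg (u : ℝ) : 0 ≤ 2 * (1 - Real.cos u) := by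
  have := Real.cos_le_one u
  linarith

theorem charFun_cosMeasure (h z : E) (m : Measure E) :
    charFun (cosMeasure h m) z =
      ∫ x, exp (⟪x, z⟫ * I) * ((2 * (1 - Real.cos ⟪h, x⟫) : ℝ) : ℂ) ∂m := by
  rw [charFun_apply, cosMeasure, integral_withDensity_eq_integral_toReal_smul
    (measurable_cosDensity h) (ae_of_all _ fun x => ENNReal.ofReal_lt_top)]
  refine integral_congr_ae (ae_of_all _ fun x => ?_)
  simp only
  rw [ENNReal.toReal_ofReal (cosDensity_nonneg _), real_smul, mul_comm]

theorem IsLevyMeasure.charFun_cosMeasure (hm : IsLevyMeasure m) (h z : E) :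
    charFun (cosMeasure h m) z = 2 * ∫ x, levyKernel z x ∂m - ∫ x, levyKernel (z + h) x ∂m -
      ∫ x, levyKernel (z - h) x ∂m := by
  have i := hm.integrable_levyKernel
  rw [_root_.charFun_cosMeasure, ← integral_const_mul, ← integral_sub ((i z).const_mul 2) (i _)]
  have e := integral_sub (((i z).const_mul 2).sub (i (z + h))) (i (z - h))
  simp only [Pi.sub_apply] at e
  rw [← e]
  exact integral_congr_ae (ae_of_all _ fun x => (levyKernel_second_difference z h x).symm)

theorem cosDensity_le (u : ℝ) : 2 * (1 - Real.cos u) ≤ u ^ 2 := by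
  have := Real.one_sub_sq_div_two_le_cos (x := u)
  linarith

theorem IsLevyMeasure.isFiniteMeasure_cosMeasure (hm : IsLevyMeasure m) (h : E) :
    IsFiniteMeasure (cosMeasure h m) := by
  refine isFiniteMeasure_withDensity_ofReal ?_
  have : Integrable (fun x : E => 2 * (1 - Real.cos ⟪h, x⟫)) m := by
    -- The density is at most `4` everywhere and at most `‖h‖ ^ 2 * ‖x‖ ^ 2` near zero.
    refine (hm.integrable.const_mul (4 + ‖h‖ ^ 2)).mono'
      (by fun_prop : Measurable _).aestronglyMeasurable (ae_of_all _ fun x => ?_)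
    rw [Real.norm_of_nonneg (cosDensity_nonneg _)]
    have h0 : (0 : ℝ) ≤ ‖h‖ ^ 2 := by positivity
    rcases le_total (‖x‖ ^ 2) 1 with hx | hx
    · rw [min_eq_right hx]
      have h1 : (⟪h, x⟫ : ℝ) ^ 2 ≤ ‖h‖ ^ 2 * ‖x‖ ^ 2 := by
        rw [← sq_abs, ← mul_pow]
        exact pow_le_pow_left₀ (abs_nonneg _) (abs_real_inner_le_norm h x) 2
      nlinarith [cosDensity_le ⟪h, x⟫, sq_nonneg ‖x‖]
    · rw [min_eq_left hx]
      have := Real.neg_one_le_cos ⟪h, x⟫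
      linarith
  exact this.2

end LevyKernel

/-! ### Uniqueness of the characteristic triplet. -/

section Uniqueness

open Complex Filter Topology

/-- Continuous logarithms on a preconnected space are determined by their value at a point. -/
theorem eq_of_exp_eq {X : Type*} [TopologicalSpace X] [PreconnectedSpace X] {f g : X → ℂ}
    (hf : Continuous f) (hg : Continuous g) (h : ∀ x, exp (f x) = exp (g x)) {a : X}
    (ha : f a = g a) : f = g :=
  isCoveringMap_exp.eq_of_comp_eq hf hg (funext fun x => Subtype.ext (h x)) a ha

variable {E : Type*} [NormedAddCommGroup E] [InnerProductSpace ℝ E]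

theorem exists_cos_inner_ne_one {x : E} (hx : x ≠ 0) : ∃ h : E, Real.cos ⟪h, x⟫ ≠ 1 := by
  -- Chosen so that `⟪h, x⟫ = π`.
  refine ⟨(Real.pi / ‖x‖ ^ 2) • x, ?_⟩
  have : ‖x‖ ^ 2 ≠ 0 := by simpa using hx
  rw [real_inner_smul_left, real_inner_self_eq_norm_sq, div_mul_cancel₀ _ this, Real.cos_pi]
  norm_num

variable [MeasurableSpace E] [BorelSpace E]

theorem charFun_add_measure (m m' : Measure E) [IsFiniteMeasure m] [IsFiniteMeasure m'] (z : E) :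
    charFun (m + m') z = charFun m z + charFun m' z := by
  have i : ∀ m : Measure E, IsFiniteMeasure m → Integrable (fun x : E => exp (⟪x, z⟫ * I)) m :=
    fun m hm => (integrable_const (1 : ℝ)).mono' (by fun_prop : Measurable _).aestronglyMeasurable
      (ae_of_all _ fun x => by rw [norm_exp_ofReal_mul_I])
  simp_rw [charFun_apply]
  exact integral_add_measure (i m inferInstance) (i m' inferInstance)

theorem charFun_smul_dirac_zero {c : ℝ} (hc : 0 ≤ c) (z : E) :
    charFun (ENNReal.ofReal c • Measure.dirac (0 : E)) z = c := by
  rw [charFun_apply, integral_smul_measure, ← charFun_apply, charFun_dirac]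
  simp [hc]

/-- On `S` the density is positive and finite, so it can be divided out. -/
theorem restrict_eq_of_cosMeasure_eq {h : E} {m m' : Measure E} {S : Set E}
    (hS : MeasurableSet S) (hS' : ∀ x ∈ S, Real.cos ⟪h, x⟫ ≠ 1)
    (H : (cosMeasure h m).restrict S = (cosMeasure h m').restrict S) :
    m.restrict S = m'.restrict S := by
  have key : ∀ m : Measure E, ((cosMeasure h m).restrict S).withDensity
      (fun x => ENNReal.ofReal (2 * (1 - Real.cos ⟪h, x⟫)))⁻¹ = m.restrict S := by
    intro m
    rw [cosMeasure, restrict_withDensity hS]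
    refine withDensity_inv_same (measurable_cosDensity h) ?_
      (ae_of_all _ fun x => ENNReal.ofReal_ne_top)
    refine (ae_restrict_mem hS).mono fun x hx => ?_
    have h1 := lt_of_le_of_ne (Real.cos_le_one ⟪h, x⟫) (hS' x hx)
    exact (ENNReal.ofReal_pos.2 (by linarith)).ne'
  rw [← key m, ← key m', H]

/-- A measure without mass at zero is determined off zero by its `cosMeasure`s. -/
theorem eq_of_restrict_cosMeasure_eq [SecondCountableTopology E] {m m' : Measure E}
    (h₀ : m {0} = 0) (h₀' : m' {0} = 0)
    (H : ∀ h : E, (cosMeasure h m).restrict {0}ᶜ = (cosMeasure h m').restrict {0}ᶜ) : m = m' := by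
  -- Countably many `h` suffice: for `x ≠ 0` the good `h` form a nonempty open set, which meets a
  -- dense sequence.
  let S : ℕ → Set E := fun n => {x | Real.cos ⟪TopologicalSpace.denseSeq E n, x⟫ ≠ 1}
  have hS : ∀ n, MeasurableSet (S n) := fun n =>
    (isClosed_eq (by fun_prop) continuous_const).measurableSet.compl
  have hU : ⋃ n, S n = {0}ᶜ := by
    ext x
    simp only [Set.mem_iUnion, Set.mem_compl_iff, Set.mem_singleton_iff]
    constructor
    · rintro ⟨n, hn⟩ rfl
      simp [S] at hn
    · intro hx
      have ho : IsOpen {h : E | Real.cos ⟪h, x⟫ ≠ 1} :=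
        (isClosed_eq (by fun_prop) continuous_const).isOpen_compl
      exact (TopologicalSpace.denseRange_denseSeq E).exists_mem_open ho
        (exists_cos_inner_ne_one hx)
  have key : m.restrict {0}ᶜ = m'.restrict {0}ᶜ := by
    rw [← hU, Measure.restrict_iUnion_congr]
    intro n
    refine restrict_eq_of_cosMeasure_eq (hS n) (fun x hx => hx) ?_
    have hsub : S n ⊆ {0}ᶜ := hU ▸ Set.subset_iUnion S n
    have := congrArg (fun m : Measure E => m.restrict (S n)) (H (TopologicalSpace.denseSeq E n))
    simpa [Measure.restrict_restrict (hS n), Set.inter_eq_left.2 hsub] using this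
  rwa [Measure.restrict_eq_self_of_ae_mem, Measure.restrict_eq_self_of_ae_mem] at key
  · exact compl_mem_ae_iff.2 h₀'
  · exact compl_mem_ae_iff.2 h₀

namespace AwaySignedMeasure

variable {ν : AwaySignedMeasure E} {m₁ m₂ : Measure E}

theorem IsDiff.integral_levyKernel (h : ν.IsDiff m₁ m₂) (h₁ : IsLevyMeasure m₁)
    (h₂ : IsLevyMeasure m₂) (z : E) :
    ν.integral (levyKernel z) = ∫ x, levyKernel z x ∂m₁ - ∫ x, levyKernel z x ∂m₂ :=
  h.integral_eq h₁ h₂ (h₁.integrable_levyKernel z) (h₂.integrable_levyKernel z)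

end AwaySignedMeasure

/-- The exponent in the Lévy-Khintchine representation. -/
noncomputable def charExponent (A : E →ₗ[ℝ] E) (ν : AwaySignedMeasure E) (γ z : E) : ℂ :=
  I * (⟪γ, z⟫ : ℝ) - 1 / 2 * (⟪z, A z⟫ : ℝ) + ν.integral (levyKernel z)

theorem isCharTriplet_iff {μ : Measure E} {A : E →ₗ[ℝ] E} {ν : AwaySignedMeasure E} {γ : E} :
    IsCharTriplet μ A ν γ ↔ A.IsSymmetric ∧ ν.IsQuasiLevyType ∧
      ∀ z, charFun μ z = exp (charExponent A ν γ z) :=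
  Iff.rfl

variable {A A' : E →ₗ[ℝ] E} {ν ν' : AwaySignedMeasure E} {γ γ' : E}

theorem charExponent_zero : charExponent A ν γ 0 = 0 := by
  have : (levyKernel (0 : E)) = 0 := funext fun x => levyKernel_zero_left x
  simp [charExponent, this, AwaySignedMeasure.integral]

theorem continuous_charExponent [FiniteDimensional ℝ E] (hν : ν.IsQuasiLevyType) :
    Continuous (charExponent A ν γ) := by
  have hA : Continuous A := A.continuous_of_finiteDimensional
  have h1 := hν.isLevyMeasure_posPart.continuous_integral_levyKernel
  have h2 := hν.isLevyMeasure_negPart.continuous_integral_levyKernel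
  unfold charExponent AwaySignedMeasure.integral
  fun_prop

theorem charExponent_second_difference (hν : ν.IsQuasiLevyType) (z h : E) :
    2 * charExponent A ν γ z - charExponent A ν γ (z + h) - charExponent A ν γ (z - h) =
      (⟪h, A h⟫ : ℝ) + charFun (cosMeasure h ν.posPart) z - charFun (cosMeasure h ν.negPart) z := by
  rw [hν.isLevyMeasure_posPart.charFun_cosMeasure, hν.isLevyMeasure_negPart.charFun_cosMeasure]
  simp only [charExponent, AwaySignedMeasure.integral, map_add, map_sub, inner_add_left,
    inner_add_right, inner_sub_left, inner_sub_right]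
  push_cast
  ring

/-- Equal exponents have equal second differences. With negative parts moved across, these are
Fourier transforms of finite positive measures; restricting to `{0}ᶜ` discards the point masses that
carry the Gaussian terms. -/
theorem ext_of_charExponent_eq [FiniteDimensional ℝ E] (hν : ν.IsQuasiLevyType)
    (hν' : ν'.IsQuasiLevyType) (H : charExponent A ν γ = charExponent A' ν' γ') : ν = ν' := by
  have hp := hν.isLevyMeasure_posPart
  have hn := hν.isLevyMeasure_negPart
  have hp' := hν'.isLevyMeasure_posPart
  have hn' := hν'.isLevyMeasure_negPart
  refine ν.isDiff_posPart_negPart.ext ν'.isDiff_posPart_negPart hp hn hp' hn'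
    (eq_of_restrict_cosMeasure_eq (hp.add hn').zero (hp'.add hn).zero fun h => ?_)
  have := hp.isFiniteMeasure_cosMeasure h
  have := hn.isFiniteMeasure_cosMeasure h
  have := hp'.isFiniteMeasure_cosMeasure h
  have := hn'.isFiniteMeasure_cosMeasure h
  set a : ℝ := ⟪h, A h⟫
  set a' : ℝ := ⟪h, A' h⟫
  -- `A` and `A'` need not be positive semidefinite; adding `|a| + |a'|` to both sides makes both
  -- point masses nonnegative.
  have ha : 0 ≤ a + (|a| + |a'|) := by linarith [neg_abs_le a, abs_nonneg a']
  have ha' : 0 ≤ a' + (|a| + |a'|) := by linarith [neg_abs_le a', abs_nonneg a]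
  have key : cosMeasure h (ν.posPart + ν'.negPart) +
        ENNReal.ofReal (a + (|a| + |a'|)) • Measure.dirac (0 : E) =
      cosMeasure h (ν'.posPart + ν.negPart) +
        ENNReal.ofReal (a' + (|a| + |a'|)) • Measure.dirac (0 : E) := by
    simp only [cosMeasure_add]
    have f1 := (Measure.dirac (0 : E)).smul_finite (ENNReal.ofReal_ne_top (r := a + (|a| + |a'|)))
    have f2 := (Measure.dirac (0 : E)).smul_finite (ENNReal.ofReal_ne_top (r := a' + (|a| + |a'|)))
    refine Measure.ext_of_charFun (funext fun z => ?_)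
    have e := charExponent_second_difference (A := A) (γ := γ) hν z h
    rw [H, charExponent_second_difference hν' z h] at e
    simp only [charFun_add_measure, charFun_smul_dirac_zero ha, charFun_smul_dirac_zero ha']
    push_cast
    linear_combination -e
  have h0 : (Measure.dirac (0 : E)).restrict {0}ᶜ = 0 := by simp [Measure.restrict_eq_zero]
  have := congrArg (fun m : Measure E => m.restrict {0}ᶜ) key
  simpa [Measure.restrict_add, Measure.restrict_smul, h0] using this

/-- Uniqueness of the characteristic triplet. -/
theorem IsCharTriplet.unique [FiniteDimensional ℝ E] {μ : Measure E}
    (h : IsCharTriplet μ A ν γ) (h' : IsCharTriplet μ A' ν' γ') : A = A' ∧ ν = ν' ∧ γ = γ' := by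
  rw [isCharTriplet_iff] at h h'
  obtain ⟨hA, hν, e⟩ := h
  obtain ⟨hA', hν', e'⟩ := h'
  have H : charExponent A ν γ = charExponent A' ν' γ' :=
    eq_of_exp_eq (continuous_charExponent hν) (continuous_charExponent hν')
      (fun z => (e z).symm.trans (e' z)) (a := 0) (by simp only [charExponent_zero])
  obtain rfl := ext_of_charExponent_eq hν hν' H
  have H' : ∀ z, I * (⟪γ, z⟫ : ℝ) - 1 / 2 * (⟪z, A z⟫ : ℝ) =
      I * (⟪γ', z⟫ : ℝ) - 1 / 2 * ((⟪z, A' z⟫ : ℝ) : ℂ) := fun z => by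
    simpa [charExponent] using congrFun H z
  -- With the jump parts cancelled, the real part is the quadratic form, which determines a
  -- symmetric operator, and the imaginary part is the drift.
  refine ⟨?_, rfl, ?_⟩
  · rw [← sub_eq_zero, ← (hA.sub hA').inner_map_self_eq_zero]
    intro z
    have := congrArg Complex.re (H' z)
    simp at this
    rw [LinearMap.sub_apply, inner_sub_left, real_inner_comm, this, real_inner_comm, sub_self]
  · refine ext_inner_right ℝ fun z => ?_
    have := congrArg Complex.im (H' z)
    simpa using this

end Uniqueness

/-! ### Infinitely divisible laws on `ℝ`: nonvanishing and logarithms. -/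

section InfinitelyDivisible

open Complex Filter Topology

theorem isProbabilityMeasure_convPow {E : Type*} [AddMonoid E] [MeasurableSpace E]
    [MeasurableAdd₂ E] (ρ : Measure E) [IsProbabilityMeasure ρ] (n : ℕ) :
    IsProbabilityMeasure (convPow ρ n) := by
  induction n with
  | zero => exact Measure.dirac.isProbabilityMeasure
  | succ n ih => exact inferInstanceAs (IsProbabilityMeasure ((convPow ρ n).conv ρ))

theorem charFun_convPow {E : Type*} [NormedAddCommGroup E] [InnerProductSpace ℝ E]
    [MeasurableSpace E] [BorelSpace E] [SecondCountableTopology E] (ρ : Measure E) [IsProbabilityMeasure ρ] (n : ℕ) (z : E) :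
    charFun (convPow ρ n) z = charFun ρ z ^ n := by
  induction n with
  | zero => simp [convPow, charFun_dirac]
  | succ n ih =>
    have := isProbabilityMeasure_convPow ρ n
    rw [convPow, charFun_conv, ih, pow_succ]

/-- Integrate `1 - cos 2u = 2(1 - cos u)(1 + cos u) ≤ 4(1 - cos u)`. -/
theorem one_sub_re_charFun_two_mul_le (σ : Measure ℝ) [IsProbabilityMeasure σ] (t : ℝ) :
    1 - (charFun σ (2 * t)).re ≤ 4 * (1 - (charFun σ t).re) := by
  have i : ∀ t : ℝ, Integrable (fun x : ℝ => Real.cos (t * x)) σ := fun t =>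
    (integrable_const (1 : ℝ)).mono' (by fun_prop : Measurable _).aestronglyMeasurable
      (ae_of_all _ fun x => Real.abs_cos_le_one _)
  have e : ∀ t : ℝ, (charFun σ t).re = ∫ x, Real.cos (t * x) ∂σ := by
    intro t
    have i' : Integrable (fun x : ℝ => exp (t * x * I)) σ :=
      (integrable_const (1 : ℝ)).mono' (by fun_prop : Measurable _).aestronglyMeasurable
        (ae_of_all _ fun x => by rw [← ofReal_mul, norm_exp_ofReal_mul_I])
    rw [charFun_apply_real]
    refine (reCLM.integral_comp_comm i').symm.trans (integral_congr_ae (ae_of_all _ fun x => ?_))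
    simp only [reCLM_apply]
    rw [← ofReal_mul, exp_ofReal_mul_I_re]
  have h1 : ∀ t : ℝ, 1 - (charFun σ t).re = ∫ x, (1 - Real.cos (t * x)) ∂σ := by
    intro t
    rw [e, integral_sub (integrable_const _) (i t)]
    simp
  rw [h1, h1, ← integral_const_mul]
  refine integral_mono ((integrable_const _).sub (i _)) (((integrable_const _).sub (i _)).const_mul _)
    fun x => ?_
  simp only
  rw [mul_assoc, Real.cos_two_mul]
  nlinarith [sq_nonneg (1 - Real.cos (t * x))]

/-- Symmetrization: the convolution of `ρ` with its reflection has characteristic function `‖charFun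
ρ‖ ^ 2`. -/
theorem one_sub_sq_norm_charFun_two_mul_le (ρ : Measure ℝ) [IsProbabilityMeasure ρ] (t : ℝ) :
    1 - ‖charFun ρ (2 * t)‖ ^ 2 ≤ 4 * (1 - ‖charFun ρ t‖ ^ 2) := by
  have hp : IsProbabilityMeasure (ρ.map fun x => (-1 : ℝ) * x) :=
    Measure.isProbabilityMeasure_map (by fun_prop)
  have e : ∀ t, (charFun (ρ.conv (ρ.map fun x => (-1 : ℝ) * x)) t).re = ‖charFun ρ t‖ ^ 2 := by
    intro t
    rw [charFun_conv, charFun_map_mul, neg_one_mul, charFun_neg, mul_conj, ofReal_re,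
      normSq_eq_norm_sq]
  simpa only [e] using one_sub_re_charFun_two_mul_le (ρ.conv (ρ.map fun x => (-1 : ℝ) * x)) t

theorem one_sub_sq_norm_charFun_two_pow_mul_le (ρ : Measure ℝ) [IsProbabilityMeasure ρ] (k : ℕ)
    (t : ℝ) : 1 - ‖charFun ρ (2 ^ k * t)‖ ^ 2 ≤ 4 ^ k * (1 - ‖charFun ρ t‖ ^ 2) := by
  induction k with
  | zero => simp
  | succ k ih =>
    have := one_sub_sq_norm_charFun_two_mul_le ρ (2 ^ k * t)
    rw [← mul_assoc, ← pow_succ'] at this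
    rw [pow_succ' (4 : ℝ), mul_assoc]
    linarith

/-- A zero at `t` is shared by every convolution root `ρ`. The doubling inequality carries it to `s
= t / 2 ^ k` as `‖charFun ρ s‖ ^ 2 ≤ 1 - 4⁻ᵏ`, uniformly in the order `n` of the root. The `n`-th
power tends to zero, although `k` is fixed with `‖charFun μ s‖ > 1 / 2`. -/
theorem IsInfinitelyDivisible.charFun_ne_zero {μ : Measure ℝ} (h : IsInfinitelyDivisible μ)
    (t : ℝ) : charFun μ t ≠ 0 := by
  intro ht
  have hμ := h.1
  have hnear : ∀ᶠ k : ℕ in atTop, 1 / 2 < ‖charFun μ ((1 / 2) ^ k * t)‖ := by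
    have h0 : Tendsto (fun k : ℕ => (1 / 2 : ℝ) ^ k * t) atTop (𝓝 0) := by
      simpa using (tendsto_pow_atTop_nhds_zero_of_lt_one (r := (1 / 2 : ℝ)) (by norm_num)
        (by norm_num)).mul_const t
    have h1 : Tendsto (fun k : ℕ => ‖charFun μ ((1 / 2) ^ k * t)‖) atTop (𝓝 ‖charFun μ 0‖) :=
      ((continuous_charFun (μ := μ)).norm.tendsto 0).comp h0
    refine h1.eventually_const_lt ?_
    simp
    norm_num
  obtain ⟨k, hk⟩ := hnear.exists
  set s := (1 / 2 : ℝ) ^ k * t with hs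
  have hst : 2 ^ k * s = t := by
    rw [hs, ← mul_assoc, ← mul_pow]
    norm_num
  have hq : ∀ n : ℕ, 1 ≤ n → (1 / 4 : ℝ) ≤ (1 - (1 / 4) ^ k) ^ n := by
    intro n hn
    obtain ⟨ρ, hρ, rfl⟩ := h.2 n hn
    rw [charFun_convPow, pow_eq_zero_iff (by omega)] at ht
    have h1 := one_sub_sq_norm_charFun_two_pow_mul_le ρ k s
    rw [hst, ht, norm_zero] at h1
    have h2 : ‖charFun ρ s‖ ^ 2 ≤ 1 - (1 / 4) ^ k := by
      have h4 : (0 : ℝ) < 4 ^ k := by positivity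
      rw [one_div, inv_pow, le_sub_iff_add_le, ← le_sub_iff_add_le', inv_le_iff_one_le_mul₀ h4]
      linarith
    rw [charFun_convPow, norm_pow] at hk
    calc (1 / 4 : ℝ) ≤ (‖charFun ρ s‖ ^ n) ^ 2 := by nlinarith
      _ = (‖charFun ρ s‖ ^ 2) ^ n := by rw [← pow_mul, ← pow_mul, mul_comm]
      _ ≤ _ := pow_le_pow_left₀ (by positivity) h2 n
  have hlim : Tendsto (fun n : ℕ => (1 - (1 / 4 : ℝ) ^ k) ^ n) atTop (𝓝 0) := by
    refine tendsto_pow_atTop_nhds_zero_of_lt_one ?_ ?_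
    · rw [sub_nonneg]
      exact pow_le_one₀ (by norm_num) (by norm_num)
    · rw [sub_lt_self_iff]
      positivity
  have := ge_of_tendsto hlim (eventually_atTop.2 ⟨1, hq⟩)
  norm_num at this

/-- Lift `φ` through the covering `exp : ℂ → ℂ \ {0}`; the line is simply connected. -/
theorem exists_continuous_log {φ : ℝ → ℂ} (hφ : Continuous φ) (h0 : φ 0 = 1)
    (h : ∀ t, φ t ≠ 0) : ∃ ψ : ℝ → ℂ, Continuous ψ ∧ ψ 0 = 0 ∧ ∀ t, φ t = exp (ψ t) := by
  obtain ⟨F, ⟨hF0, hF⟩, -⟩ := isCoveringMapOn_exp.existsUnique_continuousMap_lifts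
    (⟨φ, hφ⟩ : C(ℝ, ℂ)) (a₀ := 0) (e₀ := 0) (by simp [h0]) (fun t => h t)
  exact ⟨F, F.continuous, hF0, fun t => (congrFun hF t).symm⟩

theorem IsInfinitelyDivisible.exists_log {μ : Measure ℝ} (h : IsInfinitelyDivisible μ) :
    ∃ ψ : ℝ → ℂ, Continuous ψ ∧ ψ 0 = 0 ∧ (∀ t, charFun μ t = exp (ψ t)) ∧
      ∀ n : ℕ, ∃ ρ : Measure ℝ, IsProbabilityMeasure ρ ∧
        ∀ t, charFun ρ t = exp (ψ t / (n + 1 : ℕ)) := by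
  have hμ := h.1
  obtain ⟨ψ, hψ, hψ0, e⟩ := exists_continuous_log (continuous_charFun (μ := μ)) (by simp)
    h.charFun_ne_zero
  refine ⟨ψ, hψ, hψ0, e, fun n => ?_⟩
  obtain ⟨ρ, hρ, hn⟩ := h.2 (n + 1) (by omega)
  refine ⟨ρ, hρ, ?_⟩
  have hpow : ∀ t, charFun ρ t ^ (n + 1) = charFun μ t := fun t => by rw [← hn, charFun_convPow]
  obtain ⟨ψ', hψ', hψ0', e'⟩ := exists_continuous_log (continuous_charFun (μ := ρ)) (by simp)
    (fun t ht => h.charFun_ne_zero t (by rw [← hpow, ht, zero_pow (by omega)]))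
  -- Both are continuous logarithms of `charFun μ` vanishing at `0`; this selects the correct branch
  -- of the root.
  have key : (fun t => ((n + 1 : ℕ) : ℂ) * ψ' t) = ψ := by
    refine eq_of_exp_eq (by fun_prop) hψ (fun t => ?_) (a := 0) (by rw [hψ0, hψ0', mul_zero])
    rw [exp_nat_mul, ← e', hpow, e]
  intro t
  rw [e', ← key, mul_div_cancel_left₀]
  exact_mod_cast n.succ_ne_zero

/-- This is the derivative of `exp` at `0` along `w / (n + 1)`. -/
theorem tendsto_mul_exp_div_sub_one (w : ℂ) :
    Tendsto (fun n : ℕ => ((n + 1 : ℕ) : ℂ) * (exp (w / (n + 1 : ℕ)) - 1)) atTop (𝓝 w) := by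
  rcases eq_or_ne w 0 with rfl | hw
  · simp
  have h := (hasDerivAt_exp (0 : ℂ)).tendsto_slope
  have h0 : Tendsto (fun n : ℕ => w / ((n + 1 : ℕ) : ℂ)) atTop (𝓝[≠] 0) := by
    refine tendsto_nhdsWithin_iff.2 ⟨?_, Eventually.of_forall fun n => ?_⟩
    · simpa [div_eq_mul_inv] using (tendsto_one_div_add_atTop_nhds_zero_nat (𝕜 := ℂ)).const_mul w
    · exact div_ne_zero hw (by exact_mod_cast n.succ_ne_zero)
  have h1 := (h.comp h0).const_mul w
  rw [exp_zero, mul_one] at h1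
  refine h1.congr fun n => ?_
  have : ((n + 1 : ℕ) : ℂ) ≠ 0 := by exact_mod_cast n.succ_ne_zero
  simp only [Function.comp, slope, vsub_eq_sub, sub_zero, exp_zero, smul_eq_mul]
  field_simp

end InfinitelyDivisible

/-! ### Lévy's continuity theorem and second differences of logarithms. -/

section LevyContinuity

open Complex Filter Topology

variable {E : Type*} [NormedAddCommGroup E] [InnerProductSpace ℝ E] [FiniteDimensional ℝ E]
  [MeasurableSpace E] [BorelSpace E]

/-- Continuity of the limit at `0` gives tightness, hence relative compactness by Prokhorov; a limit
along an ultrafilter has characteristic function `f`. -/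
theorem exists_probabilityMeasure_charFun_eq {ρ : ℕ → Measure E}
    [hρ : ∀ n, IsProbabilityMeasure (ρ n)] {f : E → ℂ} (hf : ContinuousAt f 0)
    (h : ∀ t, Tendsto (fun n => charFun (ρ n) t) atTop (𝓝 (f t))) :
    ∃ G : Measure E, IsProbabilityMeasure G ∧ ∀ t, charFun G t = f t := by
  have ht := isTightMeasureSet_of_tendsto_charFun hf h
  let p : ℕ → ProbabilityMeasure E := fun n => ⟨ρ n, hρ n⟩
  have hc : IsCompact (closure (Set.range p)) := by
    refine isCompact_closure_of_isTightMeasureSet (ht.subset ?_)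
    rintro _ ⟨_, ⟨n, rfl⟩, rfl⟩
    exact ⟨n, rfl⟩
  obtain ⟨G, -, hG⟩ := hc.ultrafilter_le_nhds ((hyperfilter ℕ).map p) (by
    refine le_principal_iff.2 (mem_map.2 (univ_mem' fun n => subset_closure ⟨n, rfl⟩)))
  have hG' : Tendsto p (hyperfilter ℕ : Filter ℕ) (𝓝 G) := hG
  rw [ProbabilityMeasure.tendsto_iff_forall_integral_rclike_tendsto ℂ] at hG'
  refine ⟨G, inferInstance, fun t => ?_⟩
  have h1 := hG' (BoundedContinuousFunction.innerProbChar t)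
  simp_rw [← charFun_eq_integral_innerProbChar] at h1
  exact tendsto_nhds_unique h1 ((h t).mono_left Nat.hyperfilter_le_atTop)

/-- Lévy's continuity theorem for finite measures. -/
theorem exists_finiteMeasure_charFun_eq {m : ℕ → Measure E}
    [hm : ∀ n, IsFiniteMeasure (m n)] {f : E → ℂ} (hf : ContinuousAt f 0)
    (h : ∀ t, Tendsto (fun n => charFun (m n) t) atTop (𝓝 (f t))) :
    ∃ G : Measure E, IsFiniteMeasure G ∧ ∀ t, charFun G t = f t := by
  have hmass : Tendsto (fun n => (m n).real Set.univ) atTop (𝓝 (f 0).re) := by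
    simpa [Function.comp_def] using (continuous_re.tendsto _).comp (h 0)
  have hf0 : f 0 = (f 0).re := by
    refine tendsto_nhds_unique (h 0) ?_
    simpa [Function.comp_def] using (continuous_ofReal.tendsto _).comp hmass
  -- If the masses tend to zero the limit is the zero measure; otherwise they are eventually
  -- positive and the measures can be normalized.
  rcases (ge_of_tendsto' hmass fun n => measureReal_nonneg).eq_or_lt with h0 | h0
  · refine ⟨0, inferInstance, fun t => ?_⟩
    rw [← h0] at hmass
    rw [charFun_zero_measure]
    exact tendsto_nhds_unique (squeeze_zero_norm (fun n => norm_charFun_le t) hmass) (h t)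
  · obtain ⟨N, hN⟩ := eventually_atTop.1 (hmass.eventually_const_lt h0)
    have hN' : ∀ n, (0 : ℝ) < (m (n + N)).real Set.univ := fun n => hN _ (Nat.le_add_left N n)
    let ρ : ℕ → Measure E := fun n => (m (n + N) Set.univ)⁻¹ • m (n + N)
    have hρ : ∀ n, IsProbabilityMeasure (ρ n) := fun n => by
      have : NeZero (m (n + N)) := ⟨fun h => by simpa [h] using hN' n⟩
      exact isProbabilityMeasureSMul
    have hρc : ∀ n t, charFun (ρ n) t = ((m (n + N)).real Set.univ : ℂ)⁻¹ * charFun (m (n + N)) t := by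
      intro n t
      simp only [ρ, charFun_apply]
      rw [integral_smul_measure, ENNReal.toReal_inv, real_smul, ofReal_inv]
      rfl
    obtain ⟨G, hG, e⟩ := exists_probabilityMeasure_charFun_eq (ρ := ρ)
      (f := fun t => ((f 0).re : ℂ)⁻¹ * f t) (by fun_prop) (fun t => by
        simp_rw [hρc]
        have h1 := (continuous_ofReal.tendsto _).comp hmass
        exact ((h1.inv₀ (by exact_mod_cast h0.ne')).mul (h t)).comp (tendsto_add_atTop_nat N))
    refine ⟨ENNReal.ofReal (f 0).re • G, Measure.smul_finite _ ENNReal.ofReal_ne_top, fun t => ?_⟩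
    have h2 : charFun (ENNReal.ofReal (f 0).re • G) t = (f 0).re * charFun G t := by
      simp only [charFun_apply]
      rw [integral_smul_measure, ENNReal.toReal_ofReal h0.le, real_smul]
    rw [h2, e, mul_inv_cancel_left₀]
    exact_mod_cast h0.ne'

theorem charFun_cosMeasure_of_finite (h z : E) (m : Measure E) [IsFiniteMeasure m] :
    charFun (cosMeasure h m) z = 2 * charFun m z - charFun m (z + h) - charFun m (z - h) := by
  have i : ∀ z : E, Integrable (fun x : E => exp (⟪x, z⟫ * I)) m :=
    fun z => (integrable_const (1 : ℝ)).mono' (by fun_prop : Measurable _).aestronglyMeasurable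
      (ae_of_all _ fun x => by rw [norm_exp_ofReal_mul_I])
  rw [charFun_cosMeasure]
  simp only [charFun_apply]
  have e := integral_sub (((i z).const_mul 2).sub (i (z + h))) (i (z - h))
  simp only [Pi.sub_apply] at e
  rw [← integral_const_mul, ← integral_sub ((i z).const_mul 2) (i _), ← e]
  refine integral_congr_ae (ae_of_all _ fun x => ?_)
  simp only
  rw [← levyKernel_second_difference z h x]
  simp only [levyKernel, mul_comm I, real_inner_comm x z, real_inner_comm x (z + h),
    real_inner_comm x (z - h), inner_add_right, inner_sub_right]
  push_cast
  ring

theorem isFiniteMeasure_cosMeasure_of_finite (h : E) (m : Measure E) [IsFiniteMeasure m] :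
    IsFiniteMeasure (cosMeasure h m) := by
  refine isFiniteMeasure_withDensity_ofReal (Integrable.hasFiniteIntegral ?_)
  refine (integrable_const (4 : ℝ)).mono' (by fun_prop : Measurable _).aestronglyMeasurable
    (ae_of_all _ fun x => ?_)
  rw [Real.norm_of_nonneg (cosDensity_nonneg _)]
  linarith [Real.neg_one_le_cos ⟪h, x⟫]

/-- The measures `(n + 1) • ρ n` have transforms `(n + 1) exp(ψ / (n + 1))`. Second differences
ignore the constant `n + 1`, so they agree with those of `(n + 1)(exp(ψ / (n + 1)) - 1)`, which
converge to those of `ψ`. -/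
theorem exists_charFun_eq_second_difference {ψ : E → ℂ} (hψ : Continuous ψ)
    (H : ∀ n : ℕ, ∃ ρ : Measure E, IsProbabilityMeasure ρ ∧
        ∀ t, charFun ρ t = exp (ψ t / (n + 1 : ℕ))) (h : E) :
    ∃ G : Measure E, IsFiniteMeasure G ∧
      ∀ t, charFun G t = 2 * ψ t - ψ (t + h) - ψ (t - h) := by
  choose ρ hρ e using H
  let m : ℕ → Measure E := fun n => ((n + 1 : ℕ) : ENNReal) • ρ n
  have hm : ∀ n, IsFiniteMeasure (m n) :=
    fun n => Measure.smul_finite _ (ENNReal.natCast_ne_top _)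
  have hmc : ∀ n t, charFun (m n) t = (n + 1 : ℕ) * exp (ψ t / (n + 1 : ℕ)) := by
    intro n t
    rw [← e]
    simp only [m, charFun_apply]
    rw [integral_smul_measure, ENNReal.toReal_natCast, real_smul, ofReal_natCast]
  have := fun n => isFiniteMeasure_cosMeasure_of_finite h (m n)
  refine exists_finiteMeasure_charFun_eq (m := fun n => cosMeasure h (m n)) (by fun_prop)
    fun t => ?_
  have hl := fun t => tendsto_mul_exp_div_sub_one (ψ t)
  refine ((((hl t).const_mul 2).sub (hl (t + h))).sub (hl (t - h))).congr fun n => ?_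
  rw [charFun_cosMeasure_of_finite, hmc, hmc, hmc]
  ring

end LevyContinuity

/-! ### Continuous functions with constant second differences. -/

section QuadraticFunctions

open Complex

/-- The midpoint identity and `f 0 = 0` give additivity, and continuous additive functions are
linear. -/
theorem eq_mul_of_continuous_of_midpoint {f : ℝ → ℝ} (hf : Continuous f) (h0 : f 0 = 0)
    (H : ∀ t h, 2 * f t - f (t + h) - f (t - h) = 0) (t : ℝ) : f t = f 1 * t := by
  have h2 : ∀ x, 2 * f (x / 2) = f x := fun x => by
    have := H (x / 2) (x / 2)
    rw [add_halves, sub_self, h0] at this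
    linarith
  have hadd : ∀ x y, f (x + y) = f x + f y := fun x y => by
    have := H ((x + y) / 2) ((x - y) / 2)
    rw [h2, show (x + y) / 2 + (x - y) / 2 = x by ring,
      show (x + y) / 2 - (x - y) / 2 = y by ring] at this
    linarith
  let F : ℝ →+ ℝ := ⟨⟨f, h0⟩, hadd⟩
  have := map_real_smul F hf t 1
  rw [smul_eq_mul, mul_one, smul_eq_mul] at this
  rw [mul_comm]
  exact this

/-- The Jordan-von Neumann argument: the polarization `e (x + y) - e x - e y` is additive and
continuous in each variable, hence bilinear. -/
theorem eq_mul_sq_of_continuous_of_parallelogram {e : ℝ → ℝ} (he : Continuous e)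
    (H : ∀ t h, e (t + h) + e (t - h) = 2 * e t + 2 * e h) (t : ℝ) : e t = e 1 * t ^ 2 := by
  have e0 : e 0 = 0 := by
    have := H 0 0
    rw [add_zero, sub_zero] at this
    linarith
  have hsum : ∀ x y z, e (x + y + z) + e x + e y + e z = e (x + y) + e (x + z) + e (y + z) := by
    intro x y z
    have h1 := H (x + y) z
    have h2 := H (x + z) y
    have h3 := H x (y - z)
    have h4 := H y z
    rw [show x + z + y = x + y + z by ring, show x + z - y = x - (y - z) by ring] at h2
    rw [show x + (y - z) = x + y - z by ring] at h3
    linarith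
  have hlin : ∀ y x, e (x + y) - e x - e y = (e (1 + y) - e 1 - e y) * x := by
    intro y x
    let F : ℝ →+ ℝ := ⟨⟨fun x => e (x + y) - e x - e y, by simp [e0]⟩, fun a b => by
      simp only
      have := hsum a b y
      linarith⟩
    have hF : Continuous F := by
      change Continuous fun x => e (x + y) - e x - e y
      fun_prop
    have := map_real_smul F hF x 1
    rw [smul_eq_mul, mul_one, smul_eq_mul] at this
    rw [mul_comm]
    exact this
  have h1 := hlin t t
  have h2 := hlin 1 t
  have h3 := H t t
  have h4 := H 1 1
  rw [sub_self, e0] at h3 h4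
  rw [add_comm t 1] at h2
  have : e (1 + t) - e 1 - e t = (e (1 + 1) - e 1 - e 1) * t := by linarith
  rw [this] at h1
  nlinarith

/-- Since `c` is real, the imaginary part satisfies the midpoint identity. The real part is even, so
`t = 0` gives `c h = -2 Re η(h)`, and the identity becomes the parallelogram law. -/
theorem exists_eq_quadratic {η : ℝ → ℂ} (hη : Continuous η) (h0 : η 0 = 0)
    (hre : ∀ t, (η (-t)).re = (η t).re) {c : ℝ → ℝ}
    (H : ∀ t h, 2 * η t - η (t + h) - η (t - h) = c h) :
    ∃ a γ : ℝ, ∀ t : ℝ, η t = I * ((γ * t : ℝ) : ℂ) - 1 / 2 * ((a * t ^ 2 : ℝ) : ℂ) := by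
  have him := eq_mul_of_continuous_of_midpoint (f := fun t => (η t).im) (by fun_prop)
    (by simp [h0]) fun t h => by simpa using congrArg im (H t h)
  have hR : ∀ t h, 2 * (η t).re - (η (t + h)).re - (η (t - h)).re = c h := fun t h => by
    simpa using congrArg re (H t h)
  have hsq := eq_mul_sq_of_continuous_of_parallelogram (e := fun t => (η t).re) (by fun_prop)
    fun t h => by
      have h1 := hR t h
      have h2 := hR 0 h
      rw [zero_add, zero_sub, hre, h0, zero_re] at h2
      linarith
  refine ⟨-2 * (η 1).re, (η 1).im, fun t => Complex.ext ?_ ?_⟩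
  · rw [hsq t]
    simp only [sub_re, mul_re, I_re, I_im, ofReal_re, ofReal_im, one_re, one_im, div_ofNat_re, div_ofNat_im]
    ring
  · rw [him t]
    simp only [sub_im, mul_im, I_re, I_im, ofReal_re, ofReal_im, one_re, one_im, div_ofNat_re, div_ofNat_im]
    ring

end QuadraticFunctions

/-! ### The Lévy-Khintchine representation on `ℝ`. -/

section LevyKhintchine

open Complex Filter Topology

theorem real_inner_eq_mul (a b : ℝ) : (⟪a, b⟫ : ℝ) = a * b := by
  simp [mul_comm]

theorem cos_mul_sqrt_two_ne_one {x : ℝ} (hx : x ≠ 0) (h : Real.cos x = 1) :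
    Real.cos (√2 * x) ≠ 1 := by
  intro h'
  obtain ⟨k, hk⟩ := (Real.cos_eq_one_iff x).1 h
  obtain ⟨l, hl⟩ := (Real.cos_eq_one_iff _).1 h'
  have hpi : (2 * Real.pi) ≠ 0 := by positivity
  have hk0 : (k : ℝ) ≠ 0 := fun h0 => hx (by rw [← hk, h0, zero_mul])
  refine irrational_sqrt_two ⟨(l : ℚ) / k, ?_⟩
  push_cast
  rw [div_eq_iff hk0]
  refine mul_right_cancel₀ hpi ?_
  rw [hl, ← hk]
  ring

/-- The integral equals `2(1 - sin x / x)`, and `|sin x / x| ≤ 1 / 2`. -/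
theorem lintegral_cosDensity_ge {x : ℝ} (hx : 2 < |x|) :
    1 ≤ ∫⁻ h in Set.Icc (0 : ℝ) 1, ENNReal.ofReal (2 * (1 - Real.cos (h * x))) := by
  have hx0 : x ≠ 0 := fun h => by norm_num [h] at hx
  rw [← ofReal_integral_eq_lintegral_ofReal
    ((by fun_prop : Continuous fun h => 2 * (1 - Real.cos (h * x))).integrableOn_Icc)
    (ae_of_all _ fun h => cosDensity_nonneg _), ENNReal.one_le_ofReal,
    integral_Icc_eq_integral_Ioc, ← intervalIntegral.integral_of_le zero_le_one,
    intervalIntegral.integral_const_mul, intervalIntegral.integral_sub (by simp)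
      ((by fun_prop : Continuous fun h => Real.cos (h * x)).intervalIntegrable _ _),
    intervalIntegral.integral_comp_mul_right (fun u => Real.cos u) hx0, integral_cos]
  simp only [intervalIntegral.integral_const, sub_zero, smul_eq_mul, mul_one, one_mul, zero_mul,
    Real.sin_zero]
  have h1 : |x⁻¹ * Real.sin x| ≤ 1 / 2 := by
    rw [abs_mul, abs_inv]
    have h2 : |x|⁻¹ ≤ 1 / 2 := by
      rw [one_div]
      exact inv_anti₀ two_pos hx.le
    calc |x|⁻¹ * |Real.sin x| ≤ 1 / 2 * 1 :=
          mul_le_mul h2 (Real.abs_sin_le_one x) (abs_nonneg _) (by norm_num)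
      _ = 1 / 2 := mul_one _
  have := (abs_le.1 h1).2
  linarith

/-- For `|x| ≤ 2` use `cos x ≤ 1 - 2x² / π²` and `π² ≤ 12`. For large `x` a single frequency fails
at multiples of its period, so the average over `h` is used. -/
theorem ofReal_min_one_sq_le (x : ℝ) :
    ENNReal.ofReal (min 1 (‖x‖ ^ 2)) ≤ 3 * ENNReal.ofReal (2 * (1 - Real.cos x)) +
      ∫⁻ h in Set.Icc (0 : ℝ) 1, ENNReal.ofReal (2 * (1 - Real.cos (h * x))) := by
  rcases le_or_gt |x| 2 with hx | hx
  · refine le_add_right ?_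
    rw [show (3 : ENNReal) = ENNReal.ofReal 3 by simp, ← ENNReal.ofReal_mul (by norm_num)]
    refine ENNReal.ofReal_le_ofReal ((min_le_right _ _).trans ?_)
    have h1 := Real.cos_le_one_sub_mul_cos_sq (x := x) (hx.trans (by linarith [Real.pi_gt_three]))
    have h2 : (1 : ℝ) / 6 ≤ 2 / Real.pi ^ 2 := by
      rw [div_le_div_iff₀ (by norm_num) (by positivity)]
      nlinarith [Real.pi_lt_d2, Real.pi_pos]
    have h3 : 1 / 6 * x ^ 2 ≤ 2 / Real.pi ^ 2 * x ^ 2 := by gcongr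
    rw [Real.norm_eq_abs, sq_abs]
    linarith
  · refine le_add_left ((ENNReal.ofReal_le_ofReal (min_le_left _ _)).trans ?_)
    rw [ENNReal.ofReal_one]
    exact lintegral_cosDensity_ge hx

/-- A measure on `ℝ` without mass at zero is a Lévy measure as soon as its `cosMeasure`s have
bounded mass. -/
theorem isLevyMeasure_of_cosMeasure_le {ν : Measure ℝ} [SFinite ν] (h0 : ν {0} = 0) {C : ENNReal}
    (hC : C ≠ ⊤) (H : ∀ h ∈ Set.Icc (0 : ℝ) 1, cosMeasure h ν Set.univ ≤ C) :
    IsLevyMeasure ν := by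
  refine ⟨h0, (by fun_prop : Measurable _).aestronglyMeasurable, ?_⟩
  rw [hasFiniteIntegral_iff_ofReal (ae_of_all _ fun x => by positivity)]
  have hc : ∀ h : ℝ, ∫⁻ x, ENNReal.ofReal (2 * (1 - Real.cos (h * x))) ∂ν =
      cosMeasure h ν Set.univ := fun h => by
    simp only [cosMeasure, withDensity_apply _ MeasurableSet.univ, Measure.restrict_univ,
      real_inner_eq_mul]
  refine (lintegral_mono ofReal_min_one_sq_le).trans_lt ?_
  rw [lintegral_add_left (by fun_prop), lintegral_const_mul _ (by fun_prop),
    lintegral_lintegral_swap (by fun_prop)]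
  have h1 := hc 1
  simp only [one_mul] at h1
  rw [h1]
  refine ENNReal.add_lt_top.2 ⟨ENNReal.mul_lt_top (by simp)
    ((H 1 (by simp)).trans_lt hC.lt_top), ?_⟩
  refine (setLIntegral_mono' (g := fun _ => C) measurableSet_Icc fun h hh => ?_).trans_lt ?_
  · rw [hc]
    exact H h hh
  · simpa using hC.lt_top

/-- Finite measures `G h` that are compatible in the sense of `cosMeasure` come, off zero, from a
single measure. -/
theorem exists_cosMeasure_eq_restrict (G : ℝ → Measure ℝ) [∀ h, IsFiniteMeasure (G h)]
    (H : ∀ h k, cosMeasure k (G h) = cosMeasure h (G k)) :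
    ∃ ν : Measure ℝ, SFinite ν ∧ ν {0} = 0 ∧ ∀ h, cosMeasure h ν = (G h).restrict {0}ᶜ := by
  let f : ℝ → ℝ → ENNReal := fun h x => ENNReal.ofReal (2 * (1 - Real.cos ⟪h, x⟫))
  have hf : ∀ h, Measurable (f h) := measurable_cosDensity
  -- Each `f h` vanishes on a whole lattice; since `√2` is irrational, these two vanish together
  -- only at `0`.
  let W : ℝ → ENNReal := f 1 + f √2
  have hW : Measurable W := (hf 1).add (hf √2)
  have hS : MeasurableSet ({0}ᶜ : Set ℝ) := (measurableSet_singleton 0).compl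
  have hW0 : ∀ x ∈ ({0}ᶜ : Set ℝ), W x ≠ 0 := by
    intro x hx h
    obtain ⟨h1, h2⟩ := add_eq_zero.1 (show f 1 x + f √2 x = 0 from h)
    simp only [f, real_inner_eq_mul, one_mul, ENNReal.ofReal_eq_zero] at h1 h2
    refine cos_mul_sqrt_two_ne_one hx (le_antisymm (Real.cos_le_one _) (by linarith))
      (le_antisymm (Real.cos_le_one _) (by linarith))
  have hWt : ∀ x, W x ≠ ⊤ := fun x => ENNReal.add_ne_top.2
    ⟨ENNReal.ofReal_ne_top, ENNReal.ofReal_ne_top⟩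
  refine ⟨((G 1 + G √2).restrict {0}ᶜ).withDensity W⁻¹, inferInstance, ?_, fun h => ?_⟩
  · refine withDensity_absolutelyContinuous _ _ ?_
    rw [Measure.restrict_apply (measurableSet_singleton 0)]
    simp
  -- Compatibility with `k = 1` and `k = √2`, added; dividing by `W` gives the claim.
  · have e : ((G h).restrict {0}ᶜ).withDensity W = ((G 1 + G √2).restrict {0}ᶜ).withDensity (f h) := by
      rw [← restrict_withDensity hS, ← restrict_withDensity hS, withDensity_add_left (hf 1),
        withDensity_add_measure]
      congr 2
      exacts [H h 1, H h √2]
    have e2 := withDensity_inv_same (μ := (G h).restrict {0}ᶜ) hW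
      ((ae_restrict_mem hS).mono hW0) (ae_of_all _ hWt)
    rw [← e2, e]
    change (((G 1 + G √2).restrict {0}ᶜ).withDensity W⁻¹).withDensity (f h) =
      (((G 1 + G √2).restrict {0}ᶜ).withDensity (f h)).withDensity W⁻¹
    rw [← withDensity_mul _ hW.inv (hf h), ← withDensity_mul _ (hf h) hW.inv, mul_comm]

theorem levyKernel_neg_left (z x : ℝ) : levyKernel (-z) x = (starRingEnd ℂ) (levyKernel z x) := by
  simp only [levyKernel, map_sub, map_mul, map_one, ← exp_conj, conj_I, conj_ofReal,
    inner_neg_left]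
  push_cast
  ring_nf

/-- The Lévy-Khintchine representation of infinitely divisible distributions on `ℝ`. -/
theorem IsInfinitelyDivisible.exists_levyKhintchine {μ : Measure ℝ} (hμ : IsInfinitelyDivisible μ) :
    ∃ (a γ : ℝ) (ν : Measure ℝ), IsLevyMeasure ν ∧ ∀ t : ℝ, charFun μ t =
      exp (I * ((γ * t : ℝ) : ℂ) - 1 / 2 * ((a * t ^ 2 : ℝ) : ℂ) + ∫ x, levyKernel t x ∂ν) := by
  obtain ⟨ψ, hψ, hψ0, e, hρ⟩ := hμ.exists_log
  choose G hG hGc using exists_charFun_eq_second_difference hψ hρ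
  -- Both sides have as transform the iterated second difference of `ψ`, which is symmetric in `h`
  -- and `k`.
  obtain ⟨ν, hν, hν0, hνG⟩ := exists_cosMeasure_eq_restrict G fun h k => by
    have := isFiniteMeasure_cosMeasure_of_finite k (G h)
    have := isFiniteMeasure_cosMeasure_of_finite h (G k)
    refine Measure.ext_of_charFun (funext fun t => ?_)
    simp only [charFun_cosMeasure_of_finite, hGc]
    ring_nf
  have hGm : ∀ h, G h Set.univ = ENNReal.ofReal (2 * ψ 0 - ψ (0 + h) - ψ (0 - h)).re := fun h => by
    rw [← hGc, charFun_zero, ofReal_re, ofReal_measureReal]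
  -- The mass of `G h` is its transform at `0`, continuous in `h` and so bounded on `[0, 1]`.
  obtain ⟨C, hC⟩ := (isCompact_Icc (a := (0 : ℝ)) (b := 1)).bddAbove_image
    (f := fun h => (2 * ψ 0 - ψ (0 + h) - ψ (0 - h)).re) (by fun_prop)
  have hL : IsLevyMeasure ν := isLevyMeasure_of_cosMeasure_le hν0 (C := ENNReal.ofReal C)
    ENNReal.ofReal_ne_top fun h hh => by
      rw [hνG]
      refine (Measure.restrict_apply_le _ _).trans ?_
      rw [hGm]
      exact ENNReal.ofReal_le_ofReal (hC ⟨h, hh, rfl⟩)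
  have hsymm : ∀ t, ψ (-t) = (starRingEnd ℂ) (ψ t) := congrFun <|
    eq_of_exp_eq (a := 0) (by fun_prop) (by fun_prop)
      (fun t => by rw [← e, exp_conj, ← e, charFun_neg]) (by simp [hψ0])
  have hsymm' : ∀ t, ∫ x, levyKernel (-t) x ∂ν = (starRingEnd ℂ) (∫ x, levyKernel t x ∂ν) := by
    intro t
    simp_rw [levyKernel_neg_left]
    exact integral_conj
  have hcont := hL.continuous_integral_levyKernel
  -- The jump part accounts for `G h` off zero; what remains of the second difference is the
  -- constant `G h {0}`.
  obtain ⟨a, γ, hq⟩ := exists_eq_quadratic (η := fun t => ψ t - ∫ x, levyKernel t x ∂ν)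
    (c := fun h => (G h).real {0}) (by fun_prop) (by simp [hψ0, levyKernel_zero_left])
    (fun t => by rw [hsymm, hsymm', sub_re, sub_re, conj_re, conj_re]) fun t h => by
      have h1 := hGc h t
      rw [← Measure.restrict_add_restrict_compl (μ := G h) (measurableSet_singleton 0),
        charFun_add_measure, ← hνG, hL.charFun_cosMeasure, Measure.restrict_singleton] at h1
      have h2 : charFun (G h {0} • Measure.dirac (0 : ℝ)) t = (G h).real {0} := by
        rw [← ofReal_measureReal, charFun_smul_dirac_zero measureReal_nonneg]
      rw [h2] at h1
      linear_combination -h1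
  refine ⟨a, γ, ν, hL, fun t => ?_⟩
  rw [e, ← hq, sub_add_cancel]

end LevyKhintchine

/-! ### Quasi-infinite divisibility: triplets on `ℝ`, projections and products. -/

section QuasiInfinitelyDivisible

open Complex

/-- Exponents of numerator and denominator subtract. Both Lévy measures may be infinite near zero,
so their difference is formed only away from zero. -/
theorem IsQuasiInfinitelyDivisible.exists_isCharTriplet {μ : Measure ℝ}
    (hμ : IsQuasiInfinitelyDivisible μ) : ∃ T : ℝ × AwaySignedMeasure ℝ × ℝ,
      IsCharTriplet μ (T.1 • LinearMap.id) T.2.1 T.2.2 := by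
  obtain ⟨-, μ₁, μ₂, h₁, h₂, e⟩ := hμ
  obtain ⟨a₁, γ₁, ν₁, hν₁, e₁⟩ := h₁.exists_levyKhintchine
  obtain ⟨a₂, γ₂, ν₂, hν₂, e₂⟩ := h₂.exists_levyKhintchine
  have hd := AwaySignedMeasure.isDiff_ofDiff hν₁ hν₂
  refine ⟨⟨a₁ - a₂, .ofDiff hν₁ hν₂, γ₁ - γ₂⟩, isCharTriplet_iff.2 ⟨?_,
    hd.isQuasiLevyType hν₁ hν₂, fun z => ?_⟩⟩
  · exact LinearMap.IsSymmetric.id.smul (by simp)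
  · rw [e, e₁, e₂, ← exp_sub, charExponent, hd.integral_levyKernel hν₁ hν₂]
    simp only [LinearMap.smul_apply, LinearMap.id_apply, real_inner_eq_mul, smul_eq_mul]
    congr 1
    push_cast
    ring

theorem charFun_map_coord {d : ℕ} (m : Measure (EuclideanSpace ℝ (Fin d))) (k : Fin d) (t : ℝ) :
    charFun (m.map fun x => x k) t = charFun m (EuclideanSpace.single k t) := by
  rw [charFun_apply, charFun_apply, integral_map (by fun_prop : Measurable _).aemeasurable
    (by fun_prop : Measurable _).aestronglyMeasurable]
  simp [EuclideanSpace.inner_single_right]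

/-- Projections of convolution roots are convolution roots, as seen on characteristic functions. -/
theorem IsInfinitelyDivisible.map_coord {d : ℕ} {m : Measure (EuclideanSpace ℝ (Fin d))}
    (hm : IsInfinitelyDivisible m) (k : Fin d) :
    IsInfinitelyDivisible (m.map fun x => x k) := by
  have hmeas : Measurable fun x : EuclideanSpace ℝ (Fin d) => x k := by fun_prop
  have hm' := hm.1
  have hp := fun (ρ : Measure (EuclideanSpace ℝ (Fin d))) (hρ : IsProbabilityMeasure ρ) =>
    Measure.isProbabilityMeasure_map (μ := ρ) hmeas.aemeasurable
  have hmp := hp m hm'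
  refine ⟨hmp, fun n hn => ?_⟩
  obtain ⟨ρ, hρ, rfl⟩ := hm.2 n hn
  have hρ' := hp ρ hρ
  have := isProbabilityMeasure_convPow (ρ.map fun x => x k) n
  refine ⟨ρ.map fun x => x k, hρ', Measure.ext_of_charFun (funext fun t => ?_)⟩
  rw [charFun_convPow, charFun_map_coord, charFun_map_coord, charFun_convPow]

theorem IsInfinitelyDivisible.pi {d : ℕ} {m : Fin d → Measure ℝ}
    (hm : ∀ k, IsInfinitelyDivisible (m k)) :
    IsInfinitelyDivisible ((Measure.pi m).map (WithLp.toLp 2)) := by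
  have hp := fun (ρ : Fin d → Measure ℝ) (hρ : ∀ k, IsProbabilityMeasure (ρ k)) =>
    Measure.isProbabilityMeasure_map (μ := Measure.pi ρ)
      (f := WithLp.toLp 2) (by fun_prop : Measurable _).aemeasurable
  have hm' := fun k => (hm k).1
  have hmp := hp m hm'
  refine ⟨hmp, fun n hn => ?_⟩
  choose ρ hρ e using fun k => (hm k).2 n hn
  have hρ' := hp ρ hρ
  have := isProbabilityMeasure_convPow ((Measure.pi ρ).map (WithLp.toLp 2)) n
  refine ⟨(Measure.pi ρ).map (WithLp.toLp 2), hρ', Measure.ext_of_charFun (funext fun t => ?_)⟩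
  rw [charFun_convPow, charFun_pi, charFun_pi, ← Finset.prod_pow]
  exact Finset.prod_congr rfl fun k _ => by rw [← charFun_convPow, e]

theorem IsQuasiInfinitelyDivisible.map_coord {d : ℕ} {μ : Measure (EuclideanSpace ℝ (Fin d))}
    (hμ : IsQuasiInfinitelyDivisible μ) (k : Fin d) :
    IsQuasiInfinitelyDivisible (μ.map fun x => x k) := by
  obtain ⟨hp, μ₁, μ₂, h₁, h₂, e⟩ := hμ
  refine ⟨Measure.isProbabilityMeasure_map (by fun_prop), _, _, h₁.map_coord k, h₂.map_coord k,
    fun t => ?_⟩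
  simp only [charFun_map_coord, e]

theorem IsQuasiInfinitelyDivisible.of_charFun_eq_prod {d : ℕ}
    {μ : Measure (EuclideanSpace ℝ (Fin d))} [IsProbabilityMeasure μ] {m : Fin d → Measure ℝ}
    (hμ : ∀ z, charFun μ z = ∏ k, charFun (m k) (z k))
    (hm : ∀ k, IsQuasiInfinitelyDivisible (m k)) : IsQuasiInfinitelyDivisible μ := by
  choose _ μ₁ μ₂ h₁ h₂ e using hm
  have := fun k => (h₁ k).1
  have := fun k => (h₂ k).1
  refine ⟨inferInstance, _, _, .pi h₁, .pi h₂, fun z => ?_⟩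
  rw [hμ, charFun_pi, charFun_pi, ← Finset.prod_div_distrib]
  exact Finset.prod_congr rfl fun k _ => e k (z k)

end QuasiInfinitelyDivisible

/-! ### Measures on the coordinate axes and the triplet of a product. -/

section Axes

open Complex

variable {d : ℕ}

theorem measurable_euclideanSpace_single (k : Fin d) :
    Measurable fun x : ℝ => (EuclideanSpace.single k x : EuclideanSpace ℝ (Fin d)) :=
  (Isometry.of_dist_eq fun x y => PiLp.dist_single_same 2 (fun _ => ℝ) k x y).continuous.measurable

/-- The image of a measure on `ℝ` on the `k`-th coordinate axis. -/
noncomputable def axisMeasure (k : Fin d) (m : Measure ℝ) : Measure (EuclideanSpace ℝ (Fin d)) :=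
  m.map fun x => EuclideanSpace.single k x

theorem IsLevyMeasure.axisMeasure {m : Measure ℝ} (hm : IsLevyMeasure m) (k : Fin d) :
    IsLevyMeasure (axisMeasure k m) := by
  have hk := measurable_euclideanSpace_single k
  refine ⟨?_, ?_⟩
  · rw [_root_.axisMeasure, Measure.map_apply hk (measurableSet_singleton 0)]
    convert hm.zero
    ext x
    simp
  · rw [_root_.axisMeasure, integrable_map_measure (by fun_prop : Measurable _).aestronglyMeasurable
      hk.aemeasurable]
    simpa [Function.comp_def] using hm.integrable

theorem inner_euclideanSpace_single (z : EuclideanSpace ℝ (Fin d)) (k : Fin d) (x : ℝ) :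
    (⟪z, EuclideanSpace.single k x⟫ : ℝ) = ⟪z k, x⟫ := by
  simp [EuclideanSpace.inner_single_right]

/-- Embedding an axis preserves the norm, so the cutoff in dimension `d` restricts to the one on `ℝ`
and no drift correction arises. -/
theorem integral_levyKernel_axisMeasure (m : Measure ℝ) (k : Fin d)
    (z : EuclideanSpace ℝ (Fin d)) :
    ∫ x, levyKernel z x ∂(axisMeasure k m) = ∫ x, levyKernel (z k) x ∂m := by
  rw [axisMeasure, integral_map (measurable_euclideanSpace_single k).aemeasurable
    (measurable_levyKernel_right z).aestronglyMeasurable]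
  refine integral_congr_ae (ae_of_all _ fun x => ?_)
  simp only [levyKernel, inner_euclideanSpace_single, PiLp.norm_single]

namespace AwaySignedMeasure

/-- The sum of signed measures placed on the coordinate axes. -/
def axisSum (ν : Fin d → AwaySignedMeasure ℝ) : AwaySignedMeasure (EuclideanSpace ℝ (Fin d)) where
  toFun B := ∑ k, ((ν k).onAxis k).toFun B
  hasSum' r hr f hf hd B hB := hasSum_sum fun k _ => ((ν k).onAxis k).hasSum' r hr f hf hd B hB

/-- A representation by Lévy measures is all that integration needs; mutual singularity of the two
sums plays no role. -/
theorem isDiff_axisSum {ν : Fin d → AwaySignedMeasure ℝ} (hν : ∀ k, (ν k).IsQuasiLevyType) :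
    (axisSum ν).IsDiff (∑ k, axisMeasure k (ν k).posPart) (∑ k, axisMeasure k (ν k).negPart) := by
  have key : ∀ m : Fin d → Measure ℝ, (∀ k, IsLevyMeasure (m k)) →
      ∀ B : AwaySet (EuclideanSpace ℝ (Fin d)),
        (∑ k, axisMeasure k (m k)).real B.1 = ∑ k, (m k).real (axisSection k B).1 := by
    intro m hm B
    obtain ⟨r, hr, hrB⟩ := B.2.2
    rw [Measure.real, Measure.finsetSum_apply,
      ENNReal.toReal_sum fun k _ => (((hm k).axisMeasure k).lt_top hr hrB).ne]
    refine Finset.sum_congr rfl fun k _ => ?_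
    rw [axisMeasure, Measure.map_apply (measurable_euclideanSpace_single k) B.2.1]
    rfl
  intro B
  rw [key _ fun k => (hν k).isLevyMeasure_posPart, key _ fun k => (hν k).isLevyMeasure_negPart,
    ← Finset.sum_sub_distrib]
  change ∑ k, (ν k).toFun (axisSection k B) = _
  exact Finset.sum_congr rfl fun k _ => (ν k).isDiff_posPart_negPart (axisSection k B)

end AwaySignedMeasure

theorem inner_toEuclideanLin_diagonal (a : Fin d → ℝ) (z : EuclideanSpace ℝ (Fin d)) :
    (⟪z, Matrix.toEuclideanLin (Matrix.diagonal a) z⟫ : ℝ) = ∑ k, a k * z k * z k := by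
  rw [PiLp.inner_apply]
  refine Finset.sum_congr rfl fun k _ => ?_
  simp [Matrix.toLpLin_apply, Matrix.mulVec_diagonal]

/-- The characteristic triplet of a product distribution. -/
theorem IsCharTriplet.pi {μ : Measure (EuclideanSpace ℝ (Fin d))} {m : Fin d → Measure ℝ}
    (hμ : ∀ z, charFun μ z = ∏ k, charFun (m k) (z k)) {a γ : Fin d → ℝ}
    {ν : Fin d → AwaySignedMeasure ℝ}
    (h : ∀ k, IsCharTriplet (m k) (a k • LinearMap.id) (ν k) (γ k)) :
    IsCharTriplet μ (Matrix.toEuclideanLin (Matrix.diagonal a)) (.axisSum ν) (WithLp.toLp 2 γ) := by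
  have hν := fun k => (isCharTriplet_iff.1 (h k)).2.1
  have e := fun k => (isCharTriplet_iff.1 (h k)).2.2
  have hd := AwaySignedMeasure.isDiff_axisSum hν
  have hp := fun k => (hν k).isLevyMeasure_posPart.axisMeasure k
  have hn := fun k => (hν k).isLevyMeasure_negPart.axisMeasure k
  have hP := IsLevyMeasure.finsetSum Finset.univ hp
  have hN := IsLevyMeasure.finsetSum Finset.univ hn
  refine isCharTriplet_iff.2 ⟨?_, hd.isQuasiLevyType hP hN, fun z => ?_⟩
  · exact Matrix.isSymmetric_toEuclideanLin_iff.2 (Matrix.isHermitian_diagonal a)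
  · simp only [hμ, e, ← exp_sum]
    congr 1
    rw [charExponent, hd.integral_levyKernel hP hN, inner_toEuclideanLin_diagonal,
      integral_finsetSum_measure fun k _ => (hp k).integrable_levyKernel z,
      integral_finsetSum_measure fun k _ => (hn k).integrable_levyKernel z, PiLp.inner_apply]
    simp only [charExponent, AwaySignedMeasure.integral, integral_levyKernel_axisMeasure,
      LinearMap.smul_apply, LinearMap.id_apply, real_inner_eq_mul, smul_eq_mul,
      Finset.sum_add_distrib, Finset.sum_sub_distrib, ← Finset.mul_sum, ofReal_sum]
    simp only [mul_left_comm (z _) (a _) (z _), mul_assoc]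

end Axes

/-! ### The proposition. -/

theorem proposition3p9 {Ω : Type*} [MeasurableSpace Ω] (P : Measure Ω) [IsProbabilityMeasure P]
    {d : ℕ} (X : Fin d → Ω → ℝ) (hX : ∀ k, Measurable (X k)) (hindep : iIndepFun X P)
    (μ : Measure (EuclideanSpace ℝ (Fin d)))
    (hμ : μ = P.map fun ω => WithLp.toLp 2 fun k => X k ω) :
    (IsQuasiInfinitelyDivisible μ ↔ ∀ k, IsQuasiInfinitelyDivisible (P.map (X k))) ∧
    (IsQuasiInfinitelyDivisible μ →
      (∃! T : Matrix (Fin d) (Fin d) ℝ × AwaySignedMeasure (EuclideanSpace ℝ (Fin d)) ×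
          EuclideanSpace ℝ (Fin d),
        IsCharTriplet μ (Matrix.toEuclideanLin T.1) T.2.1 T.2.2) ∧
      (∀ k, ∃! T : ℝ × AwaySignedMeasure ℝ × ℝ,
        IsCharTriplet (P.map (X k)) (T.1 • LinearMap.id) T.2.1 T.2.2) ∧
      ∀ (A : Matrix (Fin d) (Fin d) ℝ) (ν : AwaySignedMeasure (EuclideanSpace ℝ (Fin d)))
        (γ : EuclideanSpace ℝ (Fin d))
        (a : Fin d → ℝ) (νc : Fin d → AwaySignedMeasure ℝ) (γc : Fin d → ℝ),
        IsCharTriplet μ (Matrix.toEuclideanLin A) ν γ →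
        (∀ k, IsCharTriplet (P.map (X k)) (a k • LinearMap.id) (νc k) (γc k)) →
        A = Matrix.diagonal a ∧ (∀ k, γ k = γc k) ∧
          ∀ B : AwaySet (EuclideanSpace ℝ (Fin d)),
            ν.toFun B = ∑ k, ((νc k).onAxis k).toFun B) := by
  subst hμ
  have hmeas : Measurable fun ω => (WithLp.toLp 2 fun k => X k ω : EuclideanSpace ℝ (Fin d)) := by
    fun_prop
  have hprob := Measure.isProbabilityMeasure_map (μ := P) hmeas.aemeasurable
  have hprod := (iIndepFun_iff_charFun_pi fun k => (hX k).aemeasurable).1 hindep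
  have hcoord : ∀ k, (P.map fun ω => (WithLp.toLp 2 fun k => X k ω :
      EuclideanSpace ℝ (Fin d))).map (fun x => x k) = P.map (X k) := fun k => by
    rw [Measure.map_map (by fun_prop) hmeas]
    rfl
  have hiff : IsQuasiInfinitelyDivisible (P.map fun ω => (WithLp.toLp 2 fun k => X k ω :
      EuclideanSpace ℝ (Fin d))) ↔ ∀ k, IsQuasiInfinitelyDivisible (P.map (X k)) :=
    ⟨fun h k => hcoord k ▸ h.map_coord k, fun h => .of_charFun_eq_prod hprod h⟩
  refine ⟨hiff, fun hqid => ⟨?_, fun k => ?_, ?_⟩⟩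
  · choose T hT using fun k => (hiff.1 hqid k).exists_isCharTriplet
    refine ⟨⟨_, _, _⟩, IsCharTriplet.pi hprod hT, ?_⟩
    rintro ⟨A, ν, γ⟩ h
    obtain ⟨hA, rfl, rfl⟩ := IsCharTriplet.unique h (IsCharTriplet.pi hprod hT)
    obtain rfl : A = Matrix.diagonal fun k => (T k).1 := Matrix.toEuclideanLin.injective hA
    rfl
  · obtain ⟨T, hT⟩ := (hiff.1 hqid k).exists_isCharTriplet
    refine ⟨T, hT, ?_⟩
    rintro ⟨a, ν, γ⟩ h
    obtain ⟨ha, rfl, rfl⟩ := IsCharTriplet.unique h hT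
    have : a = T.1 := by simpa using LinearMap.congr_fun ha 1
    rw [this]
  · intro A ν γ a νc γc h hc
    -- The given marginal triplets assemble to a triplet of the vector, which by uniqueness is the
    -- given one.
    obtain ⟨hA, rfl, rfl⟩ := IsCharTriplet.unique h (IsCharTriplet.pi hprod hc)
    exact ⟨Matrix.toEuclideanLin.injective hA, fun k => rfl, fun B => rfl⟩
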